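/- All vector spaces are real, of arbitrary dimension. A Lie $3$-algebra $(\mathfrak g_{-2},\mathfrak g_{-1},\mathfrak g_0,l_1,l_2,l_3,l_4)$ is a $3$-term $L_\infty$-algebra: a graded vector space $\mathfrak g=\mathfrak g_{-2}\oplus\mathfrak g_{-1}\oplus\mathfrak g_0$ with graded skew-symmetric multilinear brackets $l_i:\wedge^i\mathfrak g\to\mathfrak g$ of degree $2-i$ ($l_i=0$ for $i>4$) such that for all $k\ge1$ and all homogeneous $X_1,\dots,X_k\in\mathfrak g$ $$\sum_{i+j=k+1}(-1)^{i(j-1)}\sum_{\sigma}\operatorname{sgn}(\sigma)\,\varepsilon(\sigma)\,l_j\big(l_i(X_{\sigma(1)},\dots,X_{\sigma(i)}),X_{\sigma(i+1)},\dots,X_{\sigma(k)}\big)=0,$$ where $i,j\geq 1$, $\sigma$ runs over the $(i,k-i)$-unshuffles and $\varepsilon(\sigma)$ is the Koszul sign (a factor $-1$ for each transposition of two elements of odd degree). **Proposition.** Let $(\mathfrak g_{-2},\mathfrak g_{-1},\mathfrak g_0,l_1,l_2,l_3,l_4)$ be a Lie $3$-algebra. Put $\overline{\mathfrak g}_{-2}=\mathfrak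 g_{-2}$, $\overline{\mathfrak g}_{-1}=\operatorname{Hom}(\mathfrak g_0,\mathfrak g_{-2})\oplus\mathfrak g_{-1}$, $\overline{\mathfrak g}_0=\operatorname{Hom}(\mathfrak g_{-1},\mathfrak g_{-2})\oplus\mathfrak g_0$. For $x^i,y^i,z^i\in\mathfrak g_{-i}$ and $\phi^i,\psi^i,\varphi^i\in\operatorname{Hom}(\mathfrak g_{-i},\mathfrak g_{-2})$ define $$\mathcal D(x^2)=l_2(\cdot,x^2)|_{\mathfrak g_0}+l_1(x^2)\in\overline{\mathfrak g}_{-1},\qquad \mathcal S(\phi^1+x^0,\psi^0+y^1)=\phi^1(y^1)+\psi^0(x^0)\in\mathfrak g_{-2},$$ $$\begin{aligned} (x^0+\psi^1)\diamond(y^0+\phi^1)={}&l_2(x^0,y^0)+l_3(x^0,y^0,\cdot)|_{\mathfrak g_{-1}}+l_2(x^0,\phi^1(\cdot))-\phi^1\circ l_2(x^0,\cdot)|_{\mathfrak g_{-1}}\\ &+\psi^1\circ l_2(y^0,\cdot)|_{\mathfrak g_{-1}}-l_2(y^0,\psi^1(\cdot))+\psi^1\circ l_1\circ\phi^1-\phi^1\circ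 l_1\circ\psi^1,\\ (x^0+\psi^1)\diamond(y^1+\phi^0)={}&l_2(x^0,y^1)-l_3(x^0,\cdot,y^1)|_{\mathfrak g_0}+l_2(x^0,\phi^0(\cdot))-\phi^0\circ l_2(x^0,\cdot)|_{\mathfrak g_0}\\ &-\psi^1\circ l_2(\cdot,y^1)|_{\mathfrak g_0}+\mathcal D(\psi^1(y^1))+\psi^1\circ l_1\circ\phi^0,\\ (y^1+\phi^0)\diamond(x^0+\psi^1)={}&l_2(y^1,x^0)+l_3(x^0,\cdot,y^1)|_{\mathfrak g_0}-l_2(x^0,\phi^0(\cdot))+\phi^0\circ l_2(x^0,\cdot)|_{\mathfrak g_0}\\ &+\mathcal D(\phi^0(x^0))+\psi^1\circ l_2(\cdot,y^1)|_{\mathfrak g_0}-\psi^1\circ l_1\circ\phi^0,\\ \Omega(\phi^1+x^0,\psi^1+y^0,\varphi^1+z^0)={}&l_3(x^0,y^0,z^0)-l_4(x^0,y^0,z^0,\cdot)-\varphi^1\circ l_3(x^0,y^0,\cdot)|_{\mathfrak g_0}\\ &-\phi^1\circ l_3(y^0,z^0,\cdot)|_{\mathfrak g_0}-\psi^1\circ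 l_3(z^0,x^0,\cdot)|_{\mathfrak g_0}, \end{aligned}$$ and, for $e^0,e^0_i\in\overline{\mathfrak g}_0$ and $e^1\in\overline{\mathfrak g}_{-1}$, with $\mathfrak l_2$ as displayed below, $$T(e^0_1,e^0_2,e^1)=\tfrac16\big(\mathcal S(e^0_1,\mathfrak l_2(e^0_2,e^1))+\mathcal S(e^1,\mathfrak l_2(e^0_1,e^0_2))+\mathcal S(e^0_2,\mathfrak l_2(e^1,e^0_1))\big),$$ $$\overline\Omega(e^0_1,e^0_2,e^0_3,e^0_4)=\mathcal S(\Omega(e^0_1,e^0_2,e^0_3),e^0_4),$$ where $\mathcal S$ is regarded as symmetric, $\mathcal S(e^1,e^0)=\mathcal S(e^0,e^1)$. Then there is a Lie $3$-algebra $(\overline{\mathfrak g}_{-2},\overline{\mathfrak g}_{-1},\overline{\mathfrak g}_0,\mathfrak l_1,\mathfrak l_2,\mathfrak l_3,\mathfrak l_4)$ whose brackets are given by $$\begin{aligned} \mathfrak l_1(x^2)&=\mathcal D(x^2), & \mathfrak l_1(\phi^0+x^1)&=\phi^0\circ l_1-l_2(x^1,\cdot)|_{\mathfrak g_{-1}}+l_1(x^1),\\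 \mathfrak l_2(e^0_1,e^0_2)&=e^0_1\diamond e^0_2, & \mathfrak l_2(e^0,e^1)&=\tfrac12(e^0\diamond e^1-e^1\diamond e^0),\\ \mathfrak l_2(e^0,x^2)&=\tfrac12\mathcal S(e^0,\mathcal D x^2), & \mathfrak l_2(e^1_1,e^1_2)&=0,\\ \mathfrak l_3(e^0_1,e^0_2,e^0_3)&=\Omega(e^0_1,e^0_2,e^0_3), & \mathfrak l_3(e^0_1,e^0_2,e^1)&=-T(e^0_1,e^0_2,e^1),\\ \mathfrak l_4(e^0_1,e^0_2,e^0_3,e^0_4)&=\overline\Omega(e^0_1,e^0_2,e^0_3,e^0_4), \end{aligned}$$ for all $x^2\in\overline{\mathfrak g}_{-2}$, $\phi^0+x^1,e^1,e^1_1,e^1_2\in\overline{\mathfrak g}_{-1}$ and $e^0,e^0_i\in\overline{\mathfrak g}_0$. -/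

import Mathlib

/-- The brackets of a 3-term graded vector space `g₋₂ ⊕ g₋₁ ⊕ g₀`, given by their components.
`l k` has degree `2 - k`, so the components listed here are all those that can be nonzero, up to
reordering of the arguments. The suffix lists the arguments: `l3_001` is `l₃` on
`g₀ × g₀ × g₋₁`. -/
structure ThreeTermBrackets (g0 g1 g2 : Type*) [AddCommGroup g0] [Module ℝ g0]
    [AddCommGroup g1] [Module ℝ g1] [AddCommGroup g2] [Module ℝ g2] where
  l1_1 : g1 →ₗ[ℝ] g0
  l1_2 : g2 →ₗ[ℝ] g1
  l2_00 : g0 →ₗ[ℝ] g0 →ₗ[ℝ] g0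
  l2_01 : g0 →ₗ[ℝ] g1 →ₗ[ℝ] g1
  l2_02 : g0 →ₗ[ℝ] g2 →ₗ[ℝ] g2
  l2_11 : g1 →ₗ[ℝ] g1 →ₗ[ℝ] g2
  l3_000 : g0 →ₗ[ℝ] g0 →ₗ[ℝ] g0 →ₗ[ℝ] g1
  l3_001 : g0 →ₗ[ℝ] g0 →ₗ[ℝ] g1 →ₗ[ℝ] g2
  l4_0000 : g0 →ₗ[ℝ] g0 →ₗ[ℝ] g0 →ₗ[ℝ] g0 →ₗ[ℝ] g2

/-- The homogeneous elements of degree `-d` of `g₀ ⊕ g₋₁ ⊕ g₋₂`. -/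
def homogeneousPart (g0 g1 g2 : Type*) [AddCommGroup g0] [AddCommGroup g1] [AddCommGroup g2] :
    Fin 3 → Set (g0 × g1 × g2)
  | 0 => {v | v.2.1 = 0 ∧ v.2.2 = 0}
  | 1 => {v | v.1 = 0 ∧ v.2.2 = 0}
  | 2 => {v | v.1 = 0 ∧ v.2.1 = 0}

/-- The `(i, k - i)`-unshuffles: permutations that are increasing on the first `i` positions and
on the last `k - i` positions. -/
def unshuffles (k i : ℕ) : Finset (Equiv.Perm (Fin k)) :=
  Finset.univ.filter fun σ =>
    ∀ p q : Fin k, p < q → ((q : ℕ) < i ∨ i ≤ (p : ℕ)) → σ p < σ q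

/-- The Koszul sign of `σ` for elements of degrees `-d 0, -d 1, …`: each transposition of two
elements of odd degree contributes a factor `-1`. -/
def koszulSign {k : ℕ} (d : Fin k → Fin 3) (σ : Equiv.Perm (Fin k)) : ℤ :=
  ∏ p : Fin k, ∏ q : Fin k,
    if p < q ∧ σ q < σ p then (-1) ^ ((d (σ p) : ℕ) * (d (σ q) : ℕ)) else 1

namespace ThreeTermBrackets

variable {g0 g1 g2 : Type*} [AddCommGroup g0] [Module ℝ g0] [AddCommGroup g1] [Module ℝ g1]
  [AddCommGroup g2] [Module ℝ g2] (L : ThreeTermBrackets g0 g1 g2)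

/-- The bracket `l_k` of a list of `k` elements of the total space `g₀ ⊕ g₋₁ ⊕ g₋₂`, that is, the
multilinear extension of the components, graded skew-symmetric in the sense that exchanging
neighbouring homogeneous arguments `a`, `b` gives the factor `-(-1)^(|a||b|)`. -/
def bracket : List (g0 × g1 × g2) → g0 × g1 × g2
  | [x] => (L.l1_1 x.2.1, L.l1_2 x.2.2, 0)
  | [x, y] =>
      (L.l2_00 x.1 y.1,
       L.l2_01 x.1 y.2.1 - L.l2_01 y.1 x.2.1,
       L.l2_02 x.1 y.2.2 - L.l2_02 y.1 x.2.2 + L.l2_11 x.2.1 y.2.1)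
  | [x, y, z] =>
      (0,
       L.l3_000 x.1 y.1 z.1,
       L.l3_001 x.1 y.1 z.2.1 - L.l3_001 x.1 z.1 y.2.1 + L.l3_001 y.1 z.1 x.2.1)
  | [x, y, z, u] => (0, 0, L.l4_0000 x.1 y.1 z.1 u.1)
  | _ => 0

/-- `∑_{i+j=k+1} (-1)^(i(j-1)) ∑_σ sgn(σ) ε(σ)
l_j(l_i(x_σ(1), …, x_σ(i)), x_σ(i+1), …, x_σ(k))`, with `σ` running over the
`(i, k-i)`-unshuffles. -/
def jacobiator {k : ℕ} (d : Fin k → Fin 3) (x : Fin k → g0 × g1 × g2) : g0 × g1 × g2 :=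
  ∑ i ∈ Finset.Icc 1 k, ∑ σ ∈ unshuffles k i,
    ((-1) ^ (i * (k - i)) * (Equiv.Perm.sign σ : ℤ) * koszulSign d σ) •
      L.bracket (L.bracket ((List.ofFn fun p => x (σ p)).take i) ::
        (List.ofFn fun p => x (σ p)).drop i)

end ThreeTermBrackets

/-- A Lie 3-algebra `(g₋₂, g₋₁, g₀, l₁, l₂, l₃, l₄)`, i.e. a 3-term `L∞`-algebra. -/
structure Lie3Algebra (g0 g1 g2 : Type*) [AddCommGroup g0] [Module ℝ g0]
    [AddCommGroup g1] [Module ℝ g1] [AddCommGroup g2] [Module ℝ g2]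
    extends ThreeTermBrackets g0 g1 g2 where
  l2_00_alt : ∀ x, l2_00 x x = 0
  l2_11_symm : ∀ x y, l2_11 x y = l2_11 y x
  l3_000_alt_left : ∀ x y, l3_000 x x y = 0
  l3_000_alt_right : ∀ x y, l3_000 x y y = 0
  l3_001_alt : ∀ x y, l3_001 x x y = 0
  l4_0000_alt_left : ∀ x y z, l4_0000 x x y z = 0
  l4_0000_alt_mid : ∀ x y z, l4_0000 x y y z = 0
  l4_0000_alt_right : ∀ x y z, l4_0000 x y z z = 0
  jacobi : ∀ (k : ℕ) (d : Fin k → Fin 3) (x : Fin k → g0 × g1 × g2),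
    (∀ p, x p ∈ homogeneousPart g0 g1 g2 (d p)) →
      toThreeTermBrackets.jacobiator d x = 0

namespace Lie3Algebra

variable {g0 g1 g2 : Type*} [AddCommGroup g0] [Module ℝ g0] [AddCommGroup g1] [Module ℝ g1]
  [AddCommGroup g2] [Module ℝ g2] (L : Lie3Algebra g0 g1 g2)

/-- The map `∂ : Hom(g₀, g₋₂) ⊕ g₋₁ → Hom(g₋₁, g₋₂) ⊕ g₀`. -/
def del (e : (g0 →ₗ[ℝ] g2) × g1) : (g1 →ₗ[ℝ] g2) × g0 :=
  (e.1 ∘ₗ L.l1_1 - L.l2_11 e.2, L.l1_1 e.2)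

/-- The map `𝒟 : g₋₂ → Hom(g₀, g₋₂) ⊕ g₋₁`, `x² ↦ l₂(·, x²) + l₁(x²)`. -/
def dee (u : g2) : (g0 →ₗ[ℝ] g2) × g1 :=
  (L.l2_02.flip u, L.l1_2 u)

/-- The `g₋₂`-valued pairing `S(φ¹ + x⁰, ψ⁰ + y¹) = φ¹(y¹) + ψ⁰(x⁰)`. -/
def pairing (e : (g1 →ₗ[ℝ] g2) × g0) (f : (g0 →ₗ[ℝ] g2) × g1) : g2 :=
  e.1 f.2 + f.1 e.2

/-- `(x⁰ + ψ¹) ⋄ (y⁰ + φ¹)`. -/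
def diamond00 (e f : (g1 →ₗ[ℝ] g2) × g0) : (g1 →ₗ[ℝ] g2) × g0 :=
  (L.l3_001 e.2 f.2 + L.l2_02 e.2 ∘ₗ f.1 - f.1 ∘ₗ L.l2_01 e.2
      + e.1 ∘ₗ L.l2_01 f.2 - L.l2_02 f.2 ∘ₗ e.1
      + e.1 ∘ₗ L.l1_2 ∘ₗ f.1 - f.1 ∘ₗ L.l1_2 ∘ₗ e.1,
   L.l2_00 e.2 f.2)

/-- `(x⁰ + ψ¹) ⋄ (y¹ + φ⁰)`. -/
def diamond01 (e : (g1 →ₗ[ℝ] g2) × g0) (f : (g0 →ₗ[ℝ] g2) × g1) : (g0 →ₗ[ℝ] g2) × g1 :=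
  (-(L.l3_001 e.2).flip f.2 + L.l2_02 e.2 ∘ₗ f.1 - f.1 ∘ₗ L.l2_00 e.2
      - e.1 ∘ₗ L.l2_01.flip f.2 + e.1 ∘ₗ L.l1_2 ∘ₗ f.1,
   L.l2_01 e.2 f.2) + L.dee (e.1 f.2)

/-- `(y¹ + φ⁰) ⋄ (x⁰ + ψ¹)`. -/
def diamond10 (f : (g0 →ₗ[ℝ] g2) × g1) (e : (g1 →ₗ[ℝ] g2) × g0) : (g0 →ₗ[ℝ] g2) × g1 :=
  ((L.l3_001 e.2).flip f.2 - L.l2_02 e.2 ∘ₗ f.1 + f.1 ∘ₗ L.l2_00 e.2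
      + e.1 ∘ₗ L.l2_01.flip f.2 - e.1 ∘ₗ L.l1_2 ∘ₗ f.1,
   -L.l2_01 e.2 f.2) + L.dee (f.1 e.2)

/-- `Ω(φ¹ + x⁰, ψ¹ + y⁰, ϕ¹ + z⁰)`. -/
def omega (e f h : (g1 →ₗ[ℝ] g2) × g0) : (g0 →ₗ[ℝ] g2) × g1 :=
  (-L.l4_0000 e.2 f.2 h.2 - h.1 ∘ₗ L.l3_000 e.2 f.2 - e.1 ∘ₗ L.l3_000 f.2 h.2
      - f.1 ∘ₗ L.l3_000 h.2 e.2,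
   L.l3_000 e.2 f.2 h.2)

/-- The skew-symmetrization `½ (e⁰ ⋄ e¹ - e¹ ⋄ e⁰)`. -/
noncomputable def courant01 (e : (g1 →ₗ[ℝ] g2) × g0) (f : (g0 →ₗ[ℝ] g2) × g1) :
    (g0 →ₗ[ℝ] g2) × g1 :=
  (1 / 2 : ℝ) • (L.diamond01 e f - L.diamond10 f e)

/-- The skew-symmetrization `½ (e¹ ⋄ e⁰ - e⁰ ⋄ e¹)`. -/
noncomputable def courant10 (f : (g0 →ₗ[ℝ] g2) × g1) (e : (g1 →ₗ[ℝ] g2) × g0) :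
    (g0 →ₗ[ℝ] g2) × g1 :=
  (1 / 2 : ℝ) • (L.diamond10 f e - L.diamond01 e f)

/-- The map `T(e⁰₁, e⁰₂, e¹)`. -/
noncomputable def tee (e f : (g1 →ₗ[ℝ] g2) × g0) (h : (g0 →ₗ[ℝ] g2) × g1) : g2 :=
  (1 / 6 : ℝ) • (pairing e (L.courant01 f h) + pairing (L.diamond00 e f) h
    + pairing f (L.courant10 h e))

/-- The map `Ω̄(e⁰₁, e⁰₂, e⁰₃, e⁰₄) = S(Ω(e⁰₁, e⁰₂, e⁰₃), e⁰₄)`. -/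
def omegaBar (e f h j : (g1 →ₗ[ℝ] g2) × g0) : g2 :=
  pairing j (L.omega e f h)

end Lie3Algebra

/-! The brackets to be found are the skew-symmetrization of simpler, non-skew data, much as the skew
bracket of a Courant algebroid arises from its Dorfman bracket. That data consists of ∂, 𝒟, S, the
skew bracket ⋄ on ḡ₀, the left action ⋄ of ḡ₀ on ḡ₋₁, and Ω. The argument has two independent
halves, joined by the axioms `CLWX2Algebra`: ∂ is self-adjoint for S and intertwines the action with
the bracket, S is invariant under ⋄ with ḡ₀ acting on ḡ₋₂ by S(a, 𝒟 ·), S(Ω, ·) is alternating, and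
the Leibniz identities hold up to Ω, which itself satisfies a closedness equation.

Half one (`CLWX2Algebra.jacobiIdentities`): any such data gives a Lie 3-algebra. The skew bracket
differs from the action by ½ 𝒟S. By invariance, T reduces to terms in S(a, 𝒟S(b, f)) and S(a ⋄ b, f)
(`negT_eq`), and every Jacobi identity becomes a linear consequence of the axioms.

Half two (`Lie3Algebra.clwx`): the doubled complex of a Lie 3-algebra satisfies the axioms.
Evaluating the Hom components at a vector and sorting by the Hom arguments involved, each axiom
either holds by cancellation and the symmetries of the brackets, or is a signed sum of component
Jacobi identities of L, some of them with a Hom argument applied.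

Both halves use the component form `JacobiIdentities` of the unshuffle identities. The arity-k
identity has degree 3 - k, so in a 3-term complex only k ≤ 5 matters, and few negative-degree
arguments are allowed; the remaining unshuffles are enumerated by computation. -/

/-! ### Unshuffles and Koszul signs in low arity. -/

/-- The unshuffles of type `(i, k - i)`, recorded as functions together with their signs. -/
def signedUnshuffles (k i : ℕ) : Multiset (ℤ × (Fin k → Fin k)) :=
  (unshuffles k i).val.map fun σ => ((Equiv.Perm.sign σ : ℤ), (σ : Fin k → Fin k))

theorem unshuffles_2_1 : signedUnshuffles 2 1 =
    {(1, ![0, 1]), (-1, ![1, 0])} := by decide +kernel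

theorem unshuffles_2_2 : signedUnshuffles 2 2 =
    {(1, ![0, 1])} := by decide +kernel

theorem unshuffles_3_1 : signedUnshuffles 3 1 =
    {(1, ![0, 1, 2]), (-1, ![1, 0, 2]), (1, ![2, 0, 1])} := by decide +kernel

theorem unshuffles_3_2 : signedUnshuffles 3 2 =
    {(1, ![0, 1, 2]), (-1, ![0, 2, 1]), (1, ![1, 2, 0])} := by decide +kernel

theorem unshuffles_3_3 : signedUnshuffles 3 3 =
    {(1, ![0, 1, 2])} := by decide +kernel

theorem unshuffles_4_1 : signedUnshuffles 4 1 =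
    {(1, ![0, 1, 2, 3]), (-1, ![1, 0, 2, 3]), (1, ![2, 0, 1, 3]), (-1, ![3, 0, 1, 2])} := by
  decide +kernel

theorem unshuffles_4_2 : signedUnshuffles 4 2 =
    {(1, ![0, 1, 2, 3]), (-1, ![0, 2, 1, 3]), (1, ![0, 3, 1, 2]), (1, ![1, 2, 0, 3]),
     (-1, ![1, 3, 0, 2]), (1, ![2, 3, 0, 1])} := by decide +kernel

theorem unshuffles_4_3 : signedUnshuffles 4 3 =
    {(1, ![0, 1, 2, 3]), (-1, ![0, 1, 3, 2]), (1, ![0, 2, 3, 1]), (-1, ![1, 2, 3, 0])} := by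
  decide +kernel

theorem unshuffles_4_4 : signedUnshuffles 4 4 =
    {(1, ![0, 1, 2, 3])} := by decide +kernel

theorem unshuffles_5_2 : signedUnshuffles 5 2 =
    {(1, ![0, 1, 2, 3, 4]), (-1, ![0, 2, 1, 3, 4]), (1, ![0, 3, 1, 2, 4]), (-1, ![0, 4, 1, 2, 3]),
     (1, ![1, 2, 0, 3, 4]), (-1, ![1, 3, 0, 2, 4]), (1, ![1, 4, 0, 2, 3]), (1, ![2, 3, 0, 1, 4]),
     (-1, ![2, 4, 0, 1, 3]), (1, ![3, 4, 0, 1, 2])} := by decide +kernel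

theorem unshuffles_5_3 : signedUnshuffles 5 3 =
    {(1, ![0, 1, 2, 3, 4]), (-1, ![0, 1, 3, 2, 4]), (1, ![0, 1, 4, 2, 3]), (1, ![0, 2, 3, 1, 4]),
     (-1, ![0, 2, 4, 1, 3]), (1, ![0, 3, 4, 1, 2]), (-1, ![1, 2, 3, 0, 4]), (1, ![1, 2, 4, 0, 3]),
     (-1, ![1, 3, 4, 0, 2]), (1, ![2, 3, 4, 0, 1])} := by decide +kernel

theorem unshuffles_5_4 : signedUnshuffles 5 4 =
    {(1, ![0, 1, 2, 3, 4]), (-1, ![0, 1, 2, 4, 3]), (1, ![0, 1, 3, 4, 2]), (-1, ![0, 2, 3, 4, 1]),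
     (1, ![1, 2, 3, 4, 0])} := by decide +kernel

/-- The Koszul sign of a permutation given as a function. -/
def koszulSignFun {k : ℕ} (d : Fin k → Fin 3) (σ : Fin k → Fin k) : ℤ :=
  ∏ p : Fin k, ∏ q : Fin k,
    if p < q ∧ σ q < σ p then (-1) ^ ((d (σ p) : ℕ) * (d (σ q) : ℕ)) else 1

/-- If at most one of the elements has nonzero degree, all Koszul signs are trivial. -/
theorem koszulSignFun_eq_one {k : ℕ} (d : Fin k → Fin 3) (σ : Fin k → Fin k)
    (h : ∀ p q, p < q → d p = 0 ∨ d q = 0) : koszulSignFun d σ = 1 := by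
  refine Finset.prod_eq_one fun p _ => Finset.prod_eq_one fun q _ => ?_
  split_ifs with hpq
  · rcases h _ _ hpq.2 with h | h <;> simp [h]
  · rfl

namespace ThreeTermBrackets

variable {g0 g1 g2 : Type*} [AddCommGroup g0] [Module ℝ g0] [AddCommGroup g1] [Module ℝ g1]
  [AddCommGroup g2] [Module ℝ g2] (B : ThreeTermBrackets g0 g1 g2)

/-- The summand of the jacobiator that belongs to the unshuffle `σ` of type `(i, k - i)`. -/
def jacobiTerm {k : ℕ} (d : Fin k → Fin 3) (x : Fin k → g0 × g1 × g2) (i : ℕ)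
    (σ : ℤ × (Fin k → Fin k)) : g0 × g1 × g2 :=
  ((-1) ^ (i * (k - i)) * σ.1 * koszulSignFun d σ.2) •
    B.bracket (B.bracket ((List.ofFn fun p => x (σ.2 p)).take i) ::
      (List.ofFn fun p => x (σ.2 p)).drop i)

/-- Passing from permutations to sign–function pairs lets the enumerated tables be substituted
directly. -/
theorem jacobiator_eq_sum {k : ℕ} (d : Fin k → Fin 3) (x : Fin k → g0 × g1 × g2) :
    B.jacobiator d x =
      ∑ i ∈ Finset.Icc 1 k, ((signedUnshuffles k i).map (B.jacobiTerm d x i)).sum := by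
  simp only [jacobiator, signedUnshuffles, Multiset.map_map]
  rfl

end ThreeTermBrackets

/-- The Koszul sign of the identity. -/
theorem koszulSignFun_id {k : ℕ} (d : Fin k → Fin 3) (σ : Fin k → Fin k) (h : ∀ p, σ p = p) :
    koszulSignFun d σ = 1 := by
  refine Finset.prod_eq_one fun p _ => Finset.prod_eq_one fun q _ => if_neg ?_
  rw [h, h]
  exact fun hpq => lt_asymm hpq.1 hpq.2

section Homogeneous

variable {g0 g1 g2 : Type*} [AddCommGroup g0] [AddCommGroup g1] [AddCommGroup g2]

theorem mem_homogeneousPart_zero {v : g0 × g1 × g2} :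
    v ∈ homogeneousPart g0 g1 g2 0 ↔ ∃ a, v = (a, 0, 0) := by
  simp [homogeneousPart, Prod.ext_iff]

theorem mem_homogeneousPart_one {v : g0 × g1 × g2} :
    v ∈ homogeneousPart g0 g1 g2 1 ↔ ∃ a, v = (0, a, 0) := by
  simp [homogeneousPart, Prod.ext_iff]

theorem mem_homogeneousPart_two {v : g0 × g1 × g2} :
    v ∈ homogeneousPart g0 g1 g2 2 ↔ ∃ a, v = (0, 0, a) := by
  simp [homogeneousPart, Prod.ext_iff]

theorem fst_eq_zero_of_mem_homogeneousPart {v : g0 × g1 × g2} {d : Fin 3}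
    (hv : v ∈ homogeneousPart g0 g1 g2 d) (hd : d ≠ 0) : v.1 = 0 := by
  fin_cases d
  · exact absurd rfl hd
  · exact hv.1
  · exact hv.1

end Homogeneous

/-! ### Explicit jacobiators up to arity 5, and vanishing above. -/

namespace ThreeTermBrackets

variable {g0 g1 g2 : Type*} [AddCommGroup g0] [Module ℝ g0] [AddCommGroup g1] [Module ℝ g1]
  [AddCommGroup g2] [Module ℝ g2] (B : ThreeTermBrackets g0 g1 g2)

theorem bracket_zero_cons (l : List (g0 × g1 × g2)) : B.bracket (0 :: l) = 0 := by
  rcases l with _ | ⟨a, _ | ⟨b, _ | ⟨c, _ | ⟨d, l⟩⟩⟩⟩ <;> simp [bracket]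

theorem bracket_of_five_le {l : List (g0 × g1 × g2)} (h : 5 ≤ l.length) : B.bracket l = 0 := by
  rcases l with _ | ⟨a, _ | ⟨b, _ | ⟨c, _ | ⟨d, _ | ⟨e, l⟩⟩⟩⟩⟩
  all_goals first | rfl | (simp at h)

theorem bracket_fst_of_three_le {l : List (g0 × g1 × g2)} (h : 3 ≤ l.length) :
    (B.bracket l).1 = 0 := by
  rcases l with _ | ⟨a, _ | ⟨b, _ | ⟨c, _ | ⟨d, _ | ⟨e, l⟩⟩⟩⟩⟩
  all_goals first | rfl | (simp at h)

theorem bracket_snd_fst_of_four_le {l : List (g0 × g1 × g2)} (h : 4 ≤ l.length) :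
    (B.bracket l).2.1 = 0 := by
  rcases l with _ | ⟨a, _ | ⟨b, _ | ⟨c, _ | ⟨d, _ | ⟨e, l⟩⟩⟩⟩⟩
  all_goals first | rfl | (simp at h)

/-- A degree count: unless one of the two brackets has arity at least 5, the inner one is `l₃` or
`l₄`. The outer `l₄` sees only the g₀ part, which is then zero; the outer `l₃` can only meet an
inner `l₄`, whose values lie in g₋₂. -/
theorem bracket_bracket_eq_zero {l l' : List (g0 × g1 × g2)} (h : 6 ≤ l.length + l'.length) :
    B.bracket (B.bracket l :: l') = 0 := by
  by_cases hl : 5 ≤ l.length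
  · rw [B.bracket_of_five_le hl, bracket_zero_cons]
  by_cases hl' : 4 ≤ l'.length
  · exact B.bracket_of_five_le (by simpa using hl')
  have h1 := B.bracket_fst_of_three_le (l := l) (by omega)
  have h2 : l'.length ≤ 2 → (B.bracket l).2.1 = 0 := fun h' =>
    B.bracket_snd_fst_of_four_le (by omega)
  generalize B.bracket l = v at h1 h2
  rcases l' with _ | ⟨a, _ | ⟨b, _ | ⟨c, _ | ⟨d, l'⟩⟩⟩⟩
  all_goals simp at h hl' h2
  all_goals first | omega | simp [bracket, h1]
  simp [h2]

theorem jacobiator_of_six_le {k : ℕ} (hk : 6 ≤ k) (d : Fin k → Fin 3) (x : Fin k → g0 × g1 × g2) :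
    B.jacobiator d x = 0 := by
  refine Finset.sum_eq_zero fun i hi => Finset.sum_eq_zero fun σ _ => ?_
  rw [bracket_bracket_eq_zero, smul_zero]
  simp only [List.length_take, List.length_drop, List.length_ofFn]
  have := Finset.mem_Icc.1 hi
  omega

/-- Here and in the next lemma a bracket `l₅ = 0` occurs, so the tables of types (1, 4) and (4 + 1,
0) are not needed. -/
theorem jacobiTerm_five_one (d : Fin 5 → Fin 3) (x : Fin 5 → g0 × g1 × g2)
    (σ : ℤ × (Fin 5 → Fin 5)) : B.jacobiTerm d x 1 σ = 0 := by
  simp [jacobiTerm, List.ofFn_succ, bracket]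

theorem jacobiTerm_five_five (d : Fin 5 → Fin 3) (x : Fin 5 → g0 × g1 × g2)
    (σ : ℤ × (Fin 5 → Fin 5)) : B.jacobiTerm d x 5 σ = 0 := by
  simp [jacobiTerm, List.ofFn_succ, bracket]

theorem jacobiator_two (d : Fin 2 → Fin 3) (x : Fin 2 → g0 × g1 × g2) :
    B.jacobiator d x =
      -B.bracket [B.bracket [x 0], x 1]
      + koszulSignFun d ![1, 0] • B.bracket [B.bracket [x 1], x 0]
      + B.bracket [B.bracket [x 0, x 1]] := by
  have h : koszulSignFun d ![0, 1] = 1 := koszulSignFun_id d _ (by decide)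
  rw [jacobiator_eq_sum, show Finset.Icc 1 2 = {1, 2} from rfl]
  simp [unshuffles_2_1, unshuffles_2_2, jacobiTerm, List.ofFn_succ, h]

theorem jacobiator_three (d : Fin 3 → Fin 3) (x : Fin 3 → g0 × g1 × g2) :
    B.jacobiator d x =
      B.bracket [B.bracket [x 0], x 1, x 2]
      - koszulSignFun d ![1, 0, 2] • B.bracket [B.bracket [x 1], x 0, x 2]
      + koszulSignFun d ![2, 0, 1] • B.bracket [B.bracket [x 2], x 0, x 1]
      + B.bracket [B.bracket [x 0, x 1], x 2]
      - koszulSignFun d ![0, 2, 1] • B.bracket [B.bracket [x 0, x 2], x 1]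
      + koszulSignFun d ![1, 2, 0] • B.bracket [B.bracket [x 1, x 2], x 0]
      + B.bracket [B.bracket [x 0, x 1, x 2]] := by
  have h : koszulSignFun d ![0, 1, 2] = 1 := koszulSignFun_id d _ (by decide)
  rw [jacobiator_eq_sum, show Finset.Icc 1 3 = {1, 2, 3} from rfl]
  simp [unshuffles_3_1, unshuffles_3_2, unshuffles_3_3, jacobiTerm, List.ofFn_succ, h]
  abel

theorem jacobiator_four (d : Fin 4 → Fin 3) (x : Fin 4 → g0 × g1 × g2) :
    B.jacobiator d x =
      -B.bracket [B.bracket [x 0], x 1, x 2, x 3]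
      + koszulSignFun d ![1, 0, 2, 3] • B.bracket [B.bracket [x 1], x 0, x 2, x 3]
      - koszulSignFun d ![2, 0, 1, 3] • B.bracket [B.bracket [x 2], x 0, x 1, x 3]
      + koszulSignFun d ![3, 0, 1, 2] • B.bracket [B.bracket [x 3], x 0, x 1, x 2]
      + B.bracket [B.bracket [x 0, x 1], x 2, x 3]
      - koszulSignFun d ![0, 2, 1, 3] • B.bracket [B.bracket [x 0, x 2], x 1, x 3]
      + koszulSignFun d ![0, 3, 1, 2] • B.bracket [B.bracket [x 0, x 3], x 1, x 2]
      + koszulSignFun d ![1, 2, 0, 3] • B.bracket [B.bracket [x 1, x 2], x 0, x 3]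
      - koszulSignFun d ![1, 3, 0, 2] • B.bracket [B.bracket [x 1, x 3], x 0, x 2]
      + koszulSignFun d ![2, 3, 0, 1] • B.bracket [B.bracket [x 2, x 3], x 0, x 1]
      - B.bracket [B.bracket [x 0, x 1, x 2], x 3]
      + koszulSignFun d ![0, 1, 3, 2] • B.bracket [B.bracket [x 0, x 1, x 3], x 2]
      - koszulSignFun d ![0, 2, 3, 1] • B.bracket [B.bracket [x 0, x 2, x 3], x 1]
      + koszulSignFun d ![1, 2, 3, 0] • B.bracket [B.bracket [x 1, x 2, x 3], x 0]
      + B.bracket [B.bracket [x 0, x 1, x 2, x 3]] := by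
  have h : koszulSignFun d ![0, 1, 2, 3] = 1 := koszulSignFun_id d _ (by decide)
  rw [jacobiator_eq_sum, show Finset.Icc 1 4 = {1, 2, 3, 4} from rfl]
  simp [unshuffles_4_1, unshuffles_4_2, unshuffles_4_3, unshuffles_4_4, jacobiTerm,
    List.ofFn_succ, h]
  abel

theorem jacobiator_five (d : Fin 5 → Fin 3) (x : Fin 5 → g0 × g1 × g2) :
    B.jacobiator d x =
      B.bracket [B.bracket [x 0, x 1], x 2, x 3, x 4]
      - koszulSignFun d ![0, 2, 1, 3, 4] • B.bracket [B.bracket [x 0, x 2], x 1, x 3, x 4]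
      + koszulSignFun d ![0, 3, 1, 2, 4] • B.bracket [B.bracket [x 0, x 3], x 1, x 2, x 4]
      - koszulSignFun d ![0, 4, 1, 2, 3] • B.bracket [B.bracket [x 0, x 4], x 1, x 2, x 3]
      + koszulSignFun d ![1, 2, 0, 3, 4] • B.bracket [B.bracket [x 1, x 2], x 0, x 3, x 4]
      - koszulSignFun d ![1, 3, 0, 2, 4] • B.bracket [B.bracket [x 1, x 3], x 0, x 2, x 4]
      + koszulSignFun d ![1, 4, 0, 2, 3] • B.bracket [B.bracket [x 1, x 4], x 0, x 2, x 3]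
      + koszulSignFun d ![2, 3, 0, 1, 4] • B.bracket [B.bracket [x 2, x 3], x 0, x 1, x 4]
      - koszulSignFun d ![2, 4, 0, 1, 3] • B.bracket [B.bracket [x 2, x 4], x 0, x 1, x 3]
      + koszulSignFun d ![3, 4, 0, 1, 2] • B.bracket [B.bracket [x 3, x 4], x 0, x 1, x 2]
      + B.bracket [B.bracket [x 0, x 1, x 2], x 3, x 4]
      - koszulSignFun d ![0, 1, 3, 2, 4] • B.bracket [B.bracket [x 0, x 1, x 3], x 2, x 4]
      + koszulSignFun d ![0, 1, 4, 2, 3] • B.bracket [B.bracket [x 0, x 1, x 4], x 2, x 3]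
      + koszulSignFun d ![0, 2, 3, 1, 4] • B.bracket [B.bracket [x 0, x 2, x 3], x 1, x 4]
      - koszulSignFun d ![0, 2, 4, 1, 3] • B.bracket [B.bracket [x 0, x 2, x 4], x 1, x 3]
      + koszulSignFun d ![0, 3, 4, 1, 2] • B.bracket [B.bracket [x 0, x 3, x 4], x 1, x 2]
      - koszulSignFun d ![1, 2, 3, 0, 4] • B.bracket [B.bracket [x 1, x 2, x 3], x 0, x 4]
      + koszulSignFun d ![1, 2, 4, 0, 3] • B.bracket [B.bracket [x 1, x 2, x 4], x 0, x 3]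
      - koszulSignFun d ![1, 3, 4, 0, 2] • B.bracket [B.bracket [x 1, x 3, x 4], x 0, x 2]
      + koszulSignFun d ![2, 3, 4, 0, 1] • B.bracket [B.bracket [x 2, x 3, x 4], x 0, x 1]
      + B.bracket [B.bracket [x 0, x 1, x 2, x 3], x 4]
      - koszulSignFun d ![0, 1, 2, 4, 3] • B.bracket [B.bracket [x 0, x 1, x 2, x 4], x 3]
      + koszulSignFun d ![0, 1, 3, 4, 2] • B.bracket [B.bracket [x 0, x 1, x 3, x 4], x 2]
      - koszulSignFun d ![0, 2, 3, 4, 1] • B.bracket [B.bracket [x 0, x 2, x 3, x 4], x 1]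
      + koszulSignFun d ![1, 2, 3, 4, 0] • B.bracket [B.bracket [x 1, x 2, x 3, x 4], x 0] := by
  have h : koszulSignFun d ![0, 1, 2, 3, 4] = 1 := koszulSignFun_id d _ (by decide)
  rw [jacobiator_eq_sum, show Finset.Icc 1 5 = {1, 2, 3, 4, 5} from rfl]
  have h1 : B.jacobiTerm d x 1 = fun _ => 0 := funext (B.jacobiTerm_five_one d x)
  have h5 : B.jacobiTerm d x 5 = fun _ => 0 := funext (B.jacobiTerm_five_five d x)
  simp [unshuffles_5_2, unshuffles_5_3, unshuffles_5_4, h1, h5]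
  simp [jacobiTerm, List.ofFn_succ, h]
  abel

/-! ### The generalized Jacobi identities in components. -/

/-- The component identities that make up the generalized Jacobi identities of a Lie 3-algebra;
the suffix lists the degrees of the arguments. -/
structure JacobiIdentities : Prop where
  jac2 : ∀ a, B.l1_1 (B.l1_2 a) = 0
  jac01 : ∀ a b, B.l2_00 (B.l1_1 b) a + B.l1_1 (B.l2_01 a b) = 0
  jac02 : ∀ a b, B.l1_2 (B.l2_02 a b) - B.l2_01 a (B.l1_2 b) = 0
  jac11 : ∀ a b, B.l1_2 (B.l2_11 a b) - B.l2_01 (B.l1_1 a) b - B.l2_01 (B.l1_1 b) a = 0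
  jac12 : ∀ a b, B.l2_11 (B.l1_2 b) a - B.l2_02 (B.l1_1 a) b = 0
  jac000 : ∀ a b c, B.l2_00 (B.l2_00 a b) c - B.l2_00 (B.l2_00 a c) b + B.l2_00 (B.l2_00 b c) a
    + B.l1_1 (B.l3_000 a b c) = 0
  jac001 : ∀ a b c, B.l3_000 (B.l1_1 c) a b + B.l2_01 (B.l2_00 a b) c + B.l2_01 b (B.l2_01 a c)
    - B.l2_01 a (B.l2_01 b c) + B.l1_2 (B.l3_001 a b c) = 0
  jac002 : ∀ a b c, B.l3_001 a b (B.l1_2 c) + B.l2_02 (B.l2_00 a b) c + B.l2_02 b (B.l2_02 a c)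
    - B.l2_02 a (B.l2_02 b c) = 0
  jac011 : ∀ a b c, B.l2_11 (B.l2_01 a b) c + B.l2_11 (B.l2_01 a c) b - B.l3_001 (B.l1_1 b) a c
    - B.l3_001 (B.l1_1 c) a b - B.l2_02 a (B.l2_11 b c) = 0
  jac0000 : ∀ a b c d, B.l3_000 (B.l2_00 a b) c d - B.l3_000 (B.l2_00 a c) b d
    + B.l3_000 (B.l2_00 a d) b c + B.l3_000 (B.l2_00 b c) a d - B.l3_000 (B.l2_00 b d) a c
    + B.l3_000 (B.l2_00 c d) a b + B.l2_01 d (B.l3_000 a b c) - B.l2_01 c (B.l3_000 a b d)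
    + B.l2_01 b (B.l3_000 a c d) - B.l2_01 a (B.l3_000 b c d) + B.l1_2 (B.l4_0000 a b c d) = 0
  jac0001 : ∀ a b c d, B.l4_0000 (B.l1_1 d) a b c + B.l3_001 (B.l2_00 a b) c d
    - B.l3_001 (B.l2_00 a c) b d + B.l3_001 b c (B.l2_01 a d) + B.l3_001 (B.l2_00 b c) a d
    - B.l3_001 a c (B.l2_01 b d) + B.l3_001 a b (B.l2_01 c d) - B.l2_11 (B.l3_000 a b c) d
    - B.l2_02 c (B.l3_001 a b d) + B.l2_02 b (B.l3_001 a c d) - B.l2_02 a (B.l3_001 b c d) = 0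
  jac00000 : ∀ a b c d e, B.l4_0000 (B.l2_00 a b) c d e - B.l4_0000 (B.l2_00 a c) b d e
    + B.l4_0000 (B.l2_00 a d) b c e - B.l4_0000 (B.l2_00 a e) b c d
    + B.l4_0000 (B.l2_00 b c) a d e - B.l4_0000 (B.l2_00 b d) a c e
    + B.l4_0000 (B.l2_00 b e) a c d + B.l4_0000 (B.l2_00 c d) a b e
    - B.l4_0000 (B.l2_00 c e) a b d + B.l4_0000 (B.l2_00 d e) a b c
    + B.l3_001 d e (B.l3_000 a b c) - B.l3_001 c e (B.l3_000 a b d)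
    + B.l3_001 c d (B.l3_000 a b e) + B.l3_001 b e (B.l3_000 a c d)
    - B.l3_001 b d (B.l3_000 a c e) + B.l3_001 b c (B.l3_000 a d e)
    - B.l3_001 a e (B.l3_000 b c d) + B.l3_001 a d (B.l3_000 b c e)
    - B.l3_001 a c (B.l3_000 b d e) + B.l3_001 a b (B.l3_000 c d e)
    - B.l2_02 e (B.l4_0000 a b c d) + B.l2_02 d (B.l4_0000 a b c e)
    - B.l2_02 c (B.l4_0000 a b d e) + B.l2_02 b (B.l4_0000 a c d e)
    - B.l2_02 a (B.l4_0000 b c d e) = 0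

variable {B}

theorem JacobiIdentities.jacobiator_one_eq_zero (J : B.JacobiIdentities) (d : Fin 1 → Fin 3)
    (x : Fin 1 → g0 × g1 × g2) : B.jacobiator d x = 0 := by
  have h : signedUnshuffles 1 1 = {(1, ![0])} := by decide +kernel
  rw [jacobiator_eq_sum, Finset.Icc_self, Finset.sum_singleton, h]
  simp [jacobiTerm, List.ofFn_succ, bracket, J.jac2]

theorem JacobiIdentities.jacobiator_two_eq_zero (J : B.JacobiIdentities) (d : Fin 2 → Fin 3)
    (x : Fin 2 → g0 × g1 × g2) (hx : ∀ p, x p ∈ homogeneousPart g0 g1 g2 (d p)) :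
    B.jacobiator d x = 0 := by
  have h0 := hx 0
  have h1 := hx 1
  have hs : koszulSignFun d ![1, 0] = (-1) ^ ((d 1 : ℕ) * (d 0 : ℕ)) := by simp [koszulSignFun]
  rw [jacobiator_two, hs]
  clear hs hx
  generalize d 0 = i0 at *
  generalize d 1 = i1 at *
  fin_cases i0 <;> fin_cases i1
  all_goals
    simp only [Fin.zero_eta, Fin.mk_one, Fin.reduceFinMk, mem_homogeneousPart_zero,
      mem_homogeneousPart_one, mem_homogeneousPart_two] at h0 h1
    obtain ⟨a, h0⟩ := h0
    obtain ⟨b, h1⟩ := h1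
    simp [bracket, h0, h1]
  -- The cases left are reorderings of the component identities; the signs come from graded
  -- skew-symmetry.
  · linear_combination (norm := abel) J.jac01 a b
  · linear_combination (norm := abel) J.jac02 a b
  · linear_combination (norm := abel) -J.jac01 b a
  · linear_combination (norm := abel) J.jac11 a b
  · linear_combination (norm := abel) J.jac12 a b
  · linear_combination (norm := abel) -J.jac02 b a
  · linear_combination (norm := abel) -J.jac12 b a

theorem JacobiIdentities.jacobiator_three_eq_zero (J : B.JacobiIdentities) (d : Fin 3 → Fin 3)
    (x : Fin 3 → g0 × g1 × g2) (hx : ∀ p, x p ∈ homogeneousPart g0 g1 g2 (d p)) :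
    B.jacobiator d x = 0 := by
  have h0 := hx 0
  have h1 := hx 1
  have h2 := hx 2
  have hs1 : koszulSignFun d ![1, 0, 2] = (-1) ^ ((d 1 : ℕ) * (d 0 : ℕ)) := by
    simp [koszulSignFun, Fin.prod_univ_succ]
  have hs2 : koszulSignFun d ![0, 2, 1] = (-1) ^ ((d 2 : ℕ) * (d 1 : ℕ)) := by
    simp [koszulSignFun, Fin.prod_univ_succ]
  have hs3 : koszulSignFun d ![2, 0, 1] = (-1) ^ ((d 2 : ℕ) * (d 0 : ℕ))
      * (-1) ^ ((d 2 : ℕ) * (d 1 : ℕ)) := by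
    simp [koszulSignFun, Fin.prod_univ_succ]
  have hs4 : koszulSignFun d ![1, 2, 0] = (-1) ^ ((d 1 : ℕ) * (d 0 : ℕ))
      * (-1) ^ ((d 2 : ℕ) * (d 0 : ℕ)) := by
    simp [koszulSignFun, Fin.prod_univ_succ]
  rw [jacobiator_three, hs1, hs2, hs3, hs4]
  clear hs1 hs2 hs3 hs4 hx
  generalize d 0 = i0 at *
  generalize d 1 = i1 at *
  generalize d 2 = i2 at *
  fin_cases i0 <;> fin_cases i1 <;> fin_cases i2
  all_goals
    simp only [Fin.zero_eta, Fin.mk_one, Fin.reduceFinMk, mem_homogeneousPart_zero,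
      mem_homogeneousPart_one, mem_homogeneousPart_two] at h0 h1 h2
    obtain ⟨a, h0⟩ := h0
    obtain ⟨b, h1⟩ := h1
    obtain ⟨c, h2⟩ := h2
    simp [bracket, h0, h1, h2]
  · linear_combination (norm := abel) J.jac000 a b c
  · linear_combination (norm := abel) J.jac001 a b c
  · linear_combination (norm := abel) J.jac002 a b c
  · linear_combination (norm := abel) -J.jac001 a c b
  · linear_combination (norm := abel) J.jac011 a b c
  · linear_combination (norm := abel) -J.jac002 a c b
  · linear_combination (norm := abel) J.jac001 b c a
  · linear_combination (norm := abel) -J.jac011 b a c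
  · linear_combination (norm := abel) J.jac011 c a b
  · linear_combination (norm := abel) J.jac002 b c a

theorem JacobiIdentities.jacobiator_four_eq_zero (J : B.JacobiIdentities) (d : Fin 4 → Fin 3)
    (x : Fin 4 → g0 × g1 × g2) (hx : ∀ p, x p ∈ homogeneousPart g0 g1 g2 (d p)) :
    B.jacobiator d x = 0 := by
  -- The arity-4 jacobiator has degree -1, so two arguments of negative degree push it below degree
  -- -2. With at most one such argument all Koszul signs are 1.
  by_cases h : ∀ p q, p < q → d p = 0 ∨ d q = 0
  · simp only [jacobiator_four, koszulSignFun_eq_one d _ h, one_smul]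
    by_cases h0 : ∀ p, (x p).2.1 = 0
    · simp only [bracket, h0]
      simp
      linear_combination (norm := abel) J.jac0000 (x 0).1 (x 1).1 (x 2).1 (x 3).1
    · push Not at h0
      obtain ⟨p, hp⟩ := h0
      have hd : d p ≠ 0 := fun h0 => hp (by have := hx p; rw [h0] at this; exact this.1)
      have hd' : ∀ q, q ≠ p → (x q).2.1 = 0 := by
        intro q hq
        have hq' : d q = 0 := by
          rcases lt_or_gt_of_ne hq with hlt | hlt
          · exact (h _ _ hlt).resolve_right hd
          · exact (h _ _ hlt).resolve_left hd
        have := hx q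
        rw [hq'] at this
        exact this.1
      have hp0 := fst_eq_zero_of_mem_homogeneousPart (hx p) hd
      clear hp hd h hx
      fin_cases p
      · have h1 := hd' 1 (by decide)
        have h2 := hd' 2 (by decide)
        have h3 := hd' 3 (by decide)
        dsimp at hp0
        simp [bracket, h1, h2, h3, hp0]
        linear_combination (norm := abel) -J.jac0001 (x 1).1 (x 2).1 (x 3).1 (x 0).2.1
      · have h1 := hd' 0 (by decide)
        have h2 := hd' 2 (by decide)
        have h3 := hd' 3 (by decide)
        dsimp at hp0
        simp [bracket, h1, h2, h3, hp0]
        linear_combination (norm := abel) J.jac0001 (x 0).1 (x 2).1 (x 3).1 (x 1).2.1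
      · have h1 := hd' 0 (by decide)
        have h2 := hd' 1 (by decide)
        have h3 := hd' 3 (by decide)
        dsimp at hp0
        simp [bracket, h1, h2, h3, hp0]
        linear_combination (norm := abel) -J.jac0001 (x 0).1 (x 1).1 (x 3).1 (x 2).2.1
      · have h1 := hd' 0 (by decide)
        have h2 := hd' 1 (by decide)
        have h3 := hd' 2 (by decide)
        dsimp at hp0
        simp [bracket, h1, h2, h3, hp0]
        linear_combination (norm := abel) J.jac0001 (x 0).1 (x 1).1 (x 2).1 (x 3).2.1
  · push Not at h
    obtain ⟨p, q, hpq, hp, hq⟩ := h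
    have hp := fst_eq_zero_of_mem_homogeneousPart (hx p) hp
    have hq := fst_eq_zero_of_mem_homogeneousPart (hx q) hq
    rw [jacobiator_four]
    fin_cases p <;> fin_cases q <;> first | exact absurd hpq (by decide) | skip
    all_goals
      dsimp at hp hq
      simp [bracket, hp, hq]

theorem JacobiIdentities.jacobiator_five_eq_zero (J : B.JacobiIdentities) (d : Fin 5 → Fin 3)
    (x : Fin 5 → g0 × g1 × g2) (hx : ∀ p, x p ∈ homogeneousPart g0 g1 g2 (d p)) :
    B.jacobiator d x = 0 := by
  -- The arity-5 jacobiator has degree -2, so a single argument of negative degree kills every term.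
  by_cases h : ∀ p, d p = 0
  · simp only [jacobiator_five, koszulSignFun_eq_one d _ fun p _ _ => Or.inl (h p), one_smul]
    simp [bracket]
    linear_combination (norm := abel) J.jac00000 (x 0).1 (x 1).1 (x 2).1 (x 3).1 (x 4).1
  · push Not at h
    obtain ⟨p, hp⟩ := h
    have hp := fst_eq_zero_of_mem_homogeneousPart (hx p) hp
    rw [jacobiator_five]
    fin_cases p
    all_goals
      dsimp at hp
      simp [bracket, hp]

/-- The component identities imply the generalized Jacobi identities. -/
theorem JacobiIdentities.jacobiator_eq_zero (J : B.JacobiIdentities) (k : ℕ) (d : Fin k → Fin 3)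
    (x : Fin k → g0 × g1 × g2) (hx : ∀ p, x p ∈ homogeneousPart g0 g1 g2 (d p)) :
    B.jacobiator d x = 0 := by
  match k with
  | 0 => rfl
  | 1 => exact J.jacobiator_one_eq_zero d x
  | 2 => exact J.jacobiator_two_eq_zero d x hx
  | 3 => exact J.jacobiator_three_eq_zero d x hx
  | 4 => exact J.jacobiator_four_eq_zero d x hx
  | 5 => exact J.jacobiator_five_eq_zero d x hx
  | k + 6 => exact B.jacobiator_of_six_le (by omega) d x

end ThreeTermBrackets

namespace Lie3Algebra

variable {g0 g1 g2 : Type*} [AddCommGroup g0] [Module ℝ g0] [AddCommGroup g1] [Module ℝ g1]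
  [AddCommGroup g2] [Module ℝ g2] (L : Lie3Algebra g0 g1 g2)

/-- The generalized Jacobi identities of a Lie 3-algebra imply the component identities. -/
theorem jacobiIdentities : L.toThreeTermBrackets.JacobiIdentities where
  jac2 a := by
    have h := L.jacobi 1 ![2] ![(0, 0, a)] (by simp [homogeneousPart])
    have hu : signedUnshuffles 1 1 = {(1, ![0])} := by decide +kernel
    rw [ThreeTermBrackets.jacobiator_eq_sum, Finset.Icc_self, Finset.sum_singleton, hu] at h
    simpa [ThreeTermBrackets.jacobiTerm, List.ofFn_succ, ThreeTermBrackets.bracket,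
      koszulSignFun_id] using h
  jac01 a b := by
    have h := L.jacobi 2 ![0, 1] ![(a, 0, 0), (0, b, 0)]
      (by simp [Fin.forall_fin_succ, homogeneousPart])
    rw [ThreeTermBrackets.jacobiator_two] at h
    simp [koszulSignFun, ThreeTermBrackets.bracket] at h
    linear_combination (norm := abel) h
  jac02 a b := by
    have h := L.jacobi 2 ![0, 2] ![(a, 0, 0), (0, 0, b)]
      (by simp [Fin.forall_fin_succ, homogeneousPart])
    rw [ThreeTermBrackets.jacobiator_two] at h
    simp [koszulSignFun, ThreeTermBrackets.bracket] at h
    linear_combination (norm := abel) h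
  jac11 a b := by
    have h := L.jacobi 2 ![1, 1] ![(0, a, 0), (0, b, 0)]
      (by simp [Fin.forall_fin_succ, homogeneousPart])
    rw [ThreeTermBrackets.jacobiator_two] at h
    simp [koszulSignFun, ThreeTermBrackets.bracket] at h
    linear_combination (norm := abel) h
  jac12 a b := by
    have h := L.jacobi 2 ![1, 2] ![(0, a, 0), (0, 0, b)]
      (by simp [Fin.forall_fin_succ, homogeneousPart])
    rw [ThreeTermBrackets.jacobiator_two] at h
    simp [koszulSignFun, ThreeTermBrackets.bracket] at h
    linear_combination (norm := abel) h
  jac000 a b c := by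
    have h := L.jacobi 3 ![0, 0, 0] ![(a, 0, 0), (b, 0, 0), (c, 0, 0)]
      (by simp [Fin.forall_fin_succ, homogeneousPart])
    rw [ThreeTermBrackets.jacobiator_three] at h
    simp [koszulSignFun, Fin.prod_univ_succ, ThreeTermBrackets.bracket] at h
    linear_combination (norm := abel) h
  jac001 a b c := by
    have h := L.jacobi 3 ![0, 0, 1] ![(a, 0, 0), (b, 0, 0), (0, c, 0)]
      (by simp [Fin.forall_fin_succ, homogeneousPart])
    rw [ThreeTermBrackets.jacobiator_three] at h
    simp [koszulSignFun, Fin.prod_univ_succ, ThreeTermBrackets.bracket] at h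
    linear_combination (norm := abel) h
  jac002 a b c := by
    have h := L.jacobi 3 ![0, 0, 2] ![(a, 0, 0), (b, 0, 0), (0, 0, c)]
      (by simp [Fin.forall_fin_succ, homogeneousPart])
    rw [ThreeTermBrackets.jacobiator_three] at h
    simp [koszulSignFun, Fin.prod_univ_succ, ThreeTermBrackets.bracket] at h
    linear_combination (norm := abel) h
  jac011 a b c := by
    have h := L.jacobi 3 ![0, 1, 1] ![(a, 0, 0), (0, b, 0), (0, c, 0)]
      (by simp [Fin.forall_fin_succ, homogeneousPart])
    rw [ThreeTermBrackets.jacobiator_three] at h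
    simp [koszulSignFun, Fin.prod_univ_succ, ThreeTermBrackets.bracket] at h
    linear_combination (norm := abel) h
  jac0000 a b c d := by
    have h := L.jacobi 4 ![0, 0, 0, 0] ![(a, 0, 0), (b, 0, 0), (c, 0, 0), (d, 0, 0)]
      (by simp [Fin.forall_fin_succ, homogeneousPart])
    simp only [ThreeTermBrackets.jacobiator_four,
      koszulSignFun_eq_one ![0, 0, 0, 0] _ (by decide)] at h
    simp [ThreeTermBrackets.bracket] at h
    linear_combination (norm := abel) h
  jac0001 a b c d := by
    have h := L.jacobi 4 ![0, 0, 0, 1] ![(a, 0, 0), (b, 0, 0), (c, 0, 0), (0, d, 0)]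
      (by simp [Fin.forall_fin_succ, homogeneousPart])
    simp only [ThreeTermBrackets.jacobiator_four,
      koszulSignFun_eq_one ![0, 0, 0, 1] _ (by decide)] at h
    simp [ThreeTermBrackets.bracket] at h
    linear_combination (norm := abel) h
  jac00000 a b c d e := by
    have h := L.jacobi 5 ![0, 0, 0, 0, 0] ![(a, 0, 0), (b, 0, 0), (c, 0, 0), (d, 0, 0), (e, 0, 0)]
      (by simp [Fin.forall_fin_succ, homogeneousPart])
    simp only [ThreeTermBrackets.jacobiator_five,
      koszulSignFun_eq_one ![0, 0, 0, 0, 0] _ (by decide)] at h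
    simp [ThreeTermBrackets.bracket] at h
    linear_combination (norm := abel) h

end Lie3Algebra

/-! ### From a CLWX 2-algebra to a Lie 3-algebra by skew-symmetrization. -/

/-- The algebraic data of a CLWX 2-algebroid (over a point): a complex `G₋₂ → G₋₁ → G₀`, a pairing
`S` of `G₀` with `G₋₁`, a skew-symmetric bracket on `G₀`, a left action of `G₀` on `G₋₁` by the
Dorfman bracket and a 3-form `Ω` controlling the Leibniz identities. -/
structure CLWX2Algebra (G0 G1 G2 : Type*) [AddCommGroup G0] [Module ℝ G0]
    [AddCommGroup G1] [Module ℝ G1] [AddCommGroup G2] [Module ℝ G2] where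
  del : G1 →ₗ[ℝ] G0
  dee : G2 →ₗ[ℝ] G1
  S : G0 →ₗ[ℝ] G1 →ₗ[ℝ] G2
  br : G0 →ₗ[ℝ] G0 →ₗ[ℝ] G0
  act : G0 →ₗ[ℝ] G1 →ₗ[ℝ] G1
  Om : G0 →ₗ[ℝ] G0 →ₗ[ℝ] G0 →ₗ[ℝ] G1
  br_self : ∀ a, br a a = 0
  Om_self_left : ∀ a b, Om a a b = 0
  Om_self_right : ∀ a b, Om a b b = 0
  S_Om_self : ∀ a b c, S c (Om a b c) = 0
  del_dee : ∀ u, del (dee u) = 0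
  S_del : ∀ f g, S (del f) g = S (del g) f
  del_act : ∀ e f, del (act e f) = br e (del f)
  act_del : ∀ f g, act (del f) g + act (del g) f = dee (S (del f) g)
  act_dee : ∀ e u, act e (dee u) = dee (S e (dee u))
  S_act : ∀ a b f, S b (act a f) = S a (dee (S b f)) - S (br a b) f
  br_br : ∀ a b c, br (br a b) c - br (br a c) b + br (br b c) a + del (Om a b c) = 0
  act_act : ∀ a b f, act a (act b f) - act b (act a f) - act (br a b) f = Om a b (del f)
  act_Om : ∀ a b c d, Om (br a b) c d - Om (br a c) b d + Om (br a d) b c + Om (br b c) a d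
    - Om (br b d) a c + Om (br c d) a b + act d (Om a b c) - act c (Om a b d)
    + act b (Om a c d) - act a (Om b c d) = dee (S d (Om a b c))

namespace CLWX2Algebra

variable {G0 G1 G2 : Type*} [AddCommGroup G0] [Module ℝ G0] [AddCommGroup G1] [Module ℝ G1]
  [AddCommGroup G2] [Module ℝ G2] (C : CLWX2Algebra G0 G1 G2)

theorem br_swap (a b : G0) : C.br b a = -C.br a b := by
  have h := C.br_self (a + b)
  simp only [map_add, LinearMap.add_apply, C.br_self] at h
  linear_combination (norm := module) h

theorem Om_swap_left (a b c : G0) : C.Om b a c = -C.Om a b c := by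
  have h := C.Om_self_left (a + b) c
  simp only [map_add, LinearMap.add_apply, C.Om_self_left] at h
  linear_combination (norm := module) h

theorem Om_swap_right (a b c : G0) : C.Om a c b = -C.Om a b c := by
  have h := C.Om_self_right a (b + c)
  simp only [map_add, LinearMap.add_apply, C.Om_self_right] at h
  linear_combination (norm := module) h

/-- Polarization of `S_Om_self`. With the next two lemmas it moves any chosen argument of the
alternating form S(Ω, ·) to the outer slot, giving a normal form. -/
theorem S_Om_three (a b c d : G0) : C.S c (C.Om a b d) = -C.S d (C.Om a b c) := by
  have h := C.S_Om_self a b (c + d)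
  simp only [map_add, LinearMap.add_apply, C.S_Om_self] at h
  linear_combination (norm := module) h

theorem S_Om_two (a b c d : G0) : C.S b (C.Om a c d) = C.S d (C.Om a b c) := by
  rw [C.S_Om_three a c b d, C.Om_swap_right a b c, map_neg, neg_neg]

theorem S_Om_one (a b c d : G0) : C.S a (C.Om b c d) = -C.S d (C.Om a b c) := by
  rw [C.S_Om_three b c a d, C.Om_swap_right b a c, C.Om_swap_left a b c]
  rw [neg_neg]

/-- Moves the bracket inside Ω, where the terms of `act_Om` have it. -/
theorem S_br_Om (a b c d e : G0) :
    C.S (C.br a b) (C.Om c d e) = -C.S e (C.Om (C.br a b) c d) :=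
  C.S_Om_one _ _ _ _

/-- Self-adjointness of ∂ together with ∂𝒟 = 0. This makes the choice `l2_11 = 0` compatible with
`jac12`. -/
theorem S_del_dee (f : G1) (u : G2) : C.S (C.del f) (C.dee u) = 0 := by
  rw [C.S_del, C.del_dee, map_zero, LinearMap.zero_apply]

/-- The operators `S(a, 𝒟 ·)` represent the bracket. -/
theorem S_br_dee (a b : G0) (u : G2) : C.S (C.br a b) (C.dee u) =
    C.S a (C.dee (C.S b (C.dee u))) - C.S b (C.dee (C.S a (C.dee u))) := by
  have h := C.S_act a b (C.dee u)
  rw [C.act_dee] at h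
  linear_combination (norm := module) h

/-- The skew-symmetric bracket of `G₀` with `G₋₁`. -/
noncomputable def skewAct : G0 →ₗ[ℝ] G1 →ₗ[ℝ] G1 :=
  C.act - (1 / 2 : ℝ) • C.S.compr₂ C.dee

theorem skewAct_apply (e : G0) (f : G1) :
    C.skewAct e f = C.act e f - (1 / 2 : ℝ) • C.dee (C.S e f) := rfl

/-- The form `-T` on `G₀ × G₀ × G₋₁`. -/
noncomputable def negT : G0 →ₗ[ℝ] G0 →ₗ[ℝ] G1 →ₗ[ℝ] G2 :=
  LinearMap.mk₂ ℝ
    (fun a b => -((1 / 6 : ℝ) • (C.S a ∘ₗ C.skewAct b + C.S (C.br a b) - C.S b ∘ₗ C.skewAct a)))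
    (fun a a' b => by ext f; simp; module) (fun r a b => by ext f; simp; module)
    (fun a b b' => by ext f; simp; module) (fun r a b => by ext f; simp; module)

theorem negT_apply (a b : G0) (f : G1) : C.negT a b f =
    -((1 / 6 : ℝ) • (C.S a (C.skewAct b f) + C.S (C.br a b) f - C.S b (C.skewAct a f))) := rfl

/-- Invariance `S_act` removes the action from T, and the factor 1/6 is absorbed: the three pairings
contribute 3 S(a ⋄ b, f) and ±3/2 of the 𝒟-terms. -/
theorem negT_eq (a b : G0) (f : G1) : C.negT a b f =
    (1 / 4 : ℝ) • C.S a (C.dee (C.S b f)) - (1 / 4 : ℝ) • C.S b (C.dee (C.S a f))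
      - (1 / 2 : ℝ) • C.S (C.br a b) f := by
  simp only [negT_apply, skewAct_apply, map_sub, map_smul, C.S_act, C.br_swap a b,
    map_neg, LinearMap.neg_apply]
  module

/-- The 4-form `S(Ω(a, b, c), d)`. -/
def omBar : G0 →ₗ[ℝ] G0 →ₗ[ℝ] G0 →ₗ[ℝ] G0 →ₗ[ℝ] G2 :=
  LinearMap.mk₂ ℝ (fun a b => C.S.flip ∘ₗ C.Om a b)
    (fun a a' b => by ext; simp) (fun r a b => by ext; simp)
    (fun a b b' => by ext; simp) (fun r a b => by ext; simp)

theorem omBar_apply (a b c d : G0) : C.omBar a b c d = C.S d (C.Om a b c) := rfl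

/-- The brackets of the Lie 3-algebra of a CLWX 2-algebra. -/
noncomputable def brackets : ThreeTermBrackets G0 G1 G2 where
  l1_1 := C.del
  l1_2 := C.dee
  l2_00 := C.br
  l2_01 := C.skewAct
  l2_02 := (1 / 2 : ℝ) • C.S.compl₂ C.dee
  l2_11 := 0
  l3_000 := C.Om
  l3_001 := C.negT
  l4_0000 := C.omBar

theorem jacobiIdentities : C.brackets.JacobiIdentities where
  jac2 := C.del_dee
  jac01 a b := by
    simp [brackets, skewAct_apply, C.br_swap a, C.del_act, C.del_dee]
  jac02 a b := by
    simp [brackets, skewAct_apply, C.act_dee]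
    module
  jac11 a b := by
    simp [brackets, skewAct_apply]
    have h := C.act_del a b
    have h' := congrArg C.dee (C.S_del a b)
    linear_combination (norm := module) -h - (1 / 2 : ℝ) • h'
  jac12 a b := by
    simp [brackets, C.S_del_dee]
  jac000 a b c := C.br_br a b c
  jac001 a b c := by
    simp only [brackets, skewAct_apply, negT_eq, map_sub, map_smul, C.S_act, C.act_dee]
    have h := C.act_act a b c
    rw [C.Om_swap_right, C.Om_swap_left, neg_neg] at h
    simp only [C.br_swap a b, map_neg, LinearMap.neg_apply]
    linear_combination (norm := module) -h
  jac002 a b c := by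
    -- The commutator of S(a, 𝒟 ·) and S(b, 𝒟 ·) enters with coefficients -1/4, 1/2 and -1/4, from
    -- `l₃`, `l₂` of the bracket, and the iterated `l₂`.
    simp only [brackets, negT_eq, LinearMap.smul_apply, LinearMap.compl₂_apply, map_smul,
      C.S_br_dee]
    module
  jac011 a b c := by
    have h : C.S (C.br (C.del b) a) c + C.S (C.br (C.del c) a) b
        = -C.S a (C.dee (C.S (C.del b) c)) := by
      -- Self-adjointness at ∂(a ⋄ b) = a ⋄ ∂b, followed by invariance of S.
      have h1 := C.S_del (C.act a b) c
      rw [C.del_act, C.S_act, C.S_del c b] at h1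
      simp only [C.br_swap a, map_neg, LinearMap.neg_apply]
      linear_combination (norm := module) -h1
    simp only [brackets, negT_eq, LinearMap.zero_apply, map_zero, C.S_del_dee, C.S_del c b]
    linear_combination (norm := module) (1 / 2 : ℝ) • h
  jac0000 a b c d := by
    have h := C.act_Om a b c d
    simp only [brackets, skewAct_apply, omBar_apply, C.S_Om_one a b c d, C.S_Om_two a b c d,
      C.S_Om_three a b c d, map_neg]
    -- The four skew corrections give -½ 𝒟S(d, Ω) each and the `l₄` term gives +1, leaving the -1
    -- required by `act_Om`.
    linear_combination (norm := module) h
  jac0001 a b c d := by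
    have h : C.S (C.br (C.br a b) c) d - C.S (C.br (C.br a c) b) d + C.S (C.br (C.br b c) a) d
        - C.S c (C.Om a b (C.del d)) = 0 := by
      -- Pairing the Jacobi identity with d; self-adjointness turns ∂Ω(a, b, c) into Ω(a, b, ∂d).
      have h1 := congrArg (fun x => C.S x d) (C.br_br a b c)
      simp only [map_add, map_sub, LinearMap.add_apply, LinearMap.sub_apply, map_zero,
        LinearMap.zero_apply, C.S_del _ d, C.S_Om_three a b (C.del d) c] at h1
      linear_combination (norm := module) h1
    have h2 : C.Om (C.del d) a b = C.Om a b (C.del d) := by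
      rw [C.Om_swap_left a, C.Om_swap_right a b, neg_neg]
    simp only [brackets, negT_eq, skewAct_apply, omBar_apply, LinearMap.smul_apply,
      LinearMap.compl₂_apply, LinearMap.zero_apply, map_sub, map_smul, C.S_act, C.S_br_dee,
      C.br_swap a b, C.br_swap a c, C.br_swap b c, C.br_swap (C.br _ _), map_neg,
      LinearMap.neg_apply, h2]
    linear_combination (norm := module) -h
  jac00000 a b c d e := by
    have h := congrArg (C.S e) (C.act_Om a b c d)
    simp only [map_add, map_sub, C.S_act, C.S_br_Om] at h
    simp only [brackets, negT_eq, omBar_apply, LinearMap.smul_apply, LinearMap.compl₂_apply,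
      C.S_br_Om, C.S_Om_one a b c d, C.S_Om_two a b c d, C.S_Om_three a b c d,
      C.S_Om_one a b c e, C.S_Om_two a b c e, C.S_Om_three a b c e,
      C.S_Om_one a b d e, C.S_Om_two a b d e, C.S_Om_three a b d e,
      C.S_Om_one a c d e, C.S_Om_two a c d e, C.S_Om_three a c d e,
      C.S_Om_one b c d e, C.S_Om_two b c d e, C.S_Om_three b c d e, map_neg]
    -- Each bracket term of h occurs once through `l₄` and ½ times through `negT`. Each 𝒟-term
    -- occurs ½ times through `l2_02` and four times ¼ through `negT`. Both totals are 3/2.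
    linear_combination (norm := module) (3 / 2 : ℝ) • h

/-- The Lie 3-algebra of a CLWX 2-algebra. -/
noncomputable def toLie3Algebra : Lie3Algebra G0 G1 G2 where
  toThreeTermBrackets := C.brackets
  l2_00_alt := C.br_self
  l2_11_symm _ _ := rfl
  l3_000_alt_left := C.Om_self_left
  l3_000_alt_right := C.Om_self_right
  l3_001_alt a b := by simp [brackets, negT_eq, C.br_self]
  l4_0000_alt_left a b c := by simp [brackets, omBar_apply, C.Om_self_left]
  l4_0000_alt_mid a b c := by simp [brackets, omBar_apply, C.Om_self_right]
  l4_0000_alt_right a b c := C.S_Om_self a b c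
  jacobi := C.jacobiIdentities.jacobiator_eq_zero

end CLWX2Algebra

/-! ### Symmetries and component formulas on the doubled complex. -/

namespace Lie3Algebra

variable {g0 g1 g2 : Type*} [AddCommGroup g0] [Module ℝ g0] [AddCommGroup g1] [Module ℝ g1]
  [AddCommGroup g2] [Module ℝ g2] (L : Lie3Algebra g0 g1 g2)

theorem l2_00_swap (a b : g0) : L.l2_00 b a = -L.l2_00 a b := by
  have h := L.l2_00_alt (a + b)
  simp only [map_add, LinearMap.add_apply, L.l2_00_alt] at h
  linear_combination (norm := module) h

theorem l3_000_swap_left (a b c : g0) : L.l3_000 b a c = -L.l3_000 a b c := by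
  have h := L.l3_000_alt_left (a + b) c
  simp only [map_add, LinearMap.add_apply, L.l3_000_alt_left] at h
  linear_combination (norm := module) h

theorem l3_000_swap_right (a b c : g0) : L.l3_000 a c b = -L.l3_000 a b c := by
  have h := L.l3_000_alt_right a (b + c)
  simp only [map_add, LinearMap.add_apply, L.l3_000_alt_right] at h
  linear_combination (norm := module) h

theorem l3_000_rotate (a b c : g0) : L.l3_000 c a b = L.l3_000 a b c := by
  rw [L.l3_000_swap_left a c b, L.l3_000_swap_right a b c, neg_neg]

theorem l3_001_swap (a b : g0) (f : g1) : L.l3_001 b a f = -L.l3_001 a b f := by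
  have h := L.l3_001_alt (a + b) f
  simp only [map_add, LinearMap.add_apply, L.l3_001_alt] at h
  linear_combination (norm := module) h

theorem l4_0000_swap_left (a b c d : g0) : L.l4_0000 b a c d = -L.l4_0000 a b c d := by
  have h := L.l4_0000_alt_left (a + b) c d
  simp only [map_add, LinearMap.add_apply, L.l4_0000_alt_left] at h
  linear_combination (norm := module) h

theorem l4_0000_swap_mid (a b c d : g0) : L.l4_0000 a c b d = -L.l4_0000 a b c d := by
  have h := L.l4_0000_alt_mid a (b + c) d
  simp only [map_add, LinearMap.add_apply, L.l4_0000_alt_mid] at h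
  linear_combination (norm := module) h

theorem l4_0000_swap_right (a b c d : g0) : L.l4_0000 a b d c = -L.l4_0000 a b c d := by
  have h := L.l4_0000_alt_right a b (c + d)
  simp only [map_add, LinearMap.add_apply, L.l4_0000_alt_right] at h
  linear_combination (norm := module) h

/-- The rotations carry an inner bracket or `l1_1` to the first slot, where the component identities
have it. -/
theorem l4_0000_rotate (a b c d : g0) : L.l4_0000 a b c d = -L.l4_0000 d a b c := by
  rw [L.l4_0000_swap_left a d, L.l4_0000_swap_mid a b d, L.l4_0000_swap_right a b c d, neg_neg,
    neg_neg]

theorem l4_0000_rotate_left (a b c d : g0) : L.l4_0000 a b c d = L.l4_0000 c a b d := by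
  rw [L.l4_0000_swap_left a c, L.l4_0000_swap_mid a b c, neg_neg]

theorem diamond00_fst (e f : (g1 →ₗ[ℝ] g2) × g0) (w : g1) : (L.diamond00 e f).1 w =
    L.l3_001 e.2 f.2 w + L.l2_02 e.2 (f.1 w) - f.1 (L.l2_01 e.2 w) + e.1 (L.l2_01 f.2 w)
      - L.l2_02 f.2 (e.1 w) + e.1 (L.l1_2 (f.1 w)) - f.1 (L.l1_2 (e.1 w)) := rfl

theorem diamond00_snd (e f : (g1 →ₗ[ℝ] g2) × g0) : (L.diamond00 e f).2 = L.l2_00 e.2 f.2 := rfl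

theorem diamond01_fst (e : (g1 →ₗ[ℝ] g2) × g0) (f : (g0 →ₗ[ℝ] g2) × g1) (w : g0) :
    (L.diamond01 e f).1 w = -L.l3_001 e.2 w f.2 + L.l2_02 e.2 (f.1 w) - f.1 (L.l2_00 e.2 w)
      - e.1 (L.l2_01 w f.2) + e.1 (L.l1_2 (f.1 w)) + L.l2_02 w (e.1 f.2) := rfl

theorem diamond01_snd (e : (g1 →ₗ[ℝ] g2) × g0) (f : (g0 →ₗ[ℝ] g2) × g1) :
    (L.diamond01 e f).2 = L.l2_01 e.2 f.2 + L.l1_2 (e.1 f.2) := rfl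

theorem omega_fst (e f h : (g1 →ₗ[ℝ] g2) × g0) (w : g0) : (L.omega e f h).1 w =
    -L.l4_0000 e.2 f.2 h.2 w - h.1 (L.l3_000 e.2 f.2 w) - e.1 (L.l3_000 f.2 h.2 w)
      - f.1 (L.l3_000 h.2 e.2 w) := rfl

theorem omega_snd (e f h : (g1 →ₗ[ℝ] g2) × g0) : (L.omega e f h).2 = L.l3_000 e.2 f.2 h.2 := rfl

theorem del_fst (f : (g0 →ₗ[ℝ] g2) × g1) (w : g1) :
    (L.del f).1 w = f.1 (L.l1_1 w) - L.l2_11 f.2 w := rfl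

theorem del_snd (f : (g0 →ₗ[ℝ] g2) × g1) : (L.del f).2 = L.l1_1 f.2 := rfl

theorem dee_fst (u : g2) (w : g0) : (L.dee u).1 w = L.l2_02 w u := rfl

theorem dee_snd (u : g2) : (L.dee u).2 = L.l1_2 u := rfl

theorem pairing_apply (e : (g1 →ₗ[ℝ] g2) × g0) (f : (g0 →ₗ[ℝ] g2) × g1) :
    pairing e f = e.1 f.2 + f.1 e.2 := rfl

theorem hom_prod_ext {V W X : Type*} [AddCommGroup V] [Module ℝ V] [AddCommGroup W] [Module ℝ W]
    {e f : (V →ₗ[ℝ] W) × X} (h1 : ∀ w, e.1 w = f.1 w) (h2 : e.2 = f.2) : e = f :=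
  Prod.ext (LinearMap.ext h1) h2

/-- `∂` as a linear map. -/
def delHom : (g0 →ₗ[ℝ] g2) × g1 →ₗ[ℝ] (g1 →ₗ[ℝ] g2) × g0 where
  toFun := L.del
  map_add' f f' := hom_prod_ext (fun w => by simp [del_fst]; abel) (by simp [del_snd])
  map_smul' r f := hom_prod_ext (fun w => by simp [del_fst, smul_sub]) (by simp [del_snd])

/-- `𝒟` as a linear map. -/
def deeHom : g2 →ₗ[ℝ] (g0 →ₗ[ℝ] g2) × g1 := L.l2_02.flip.prod L.l1_2

/-- The pairing `S` as a bilinear map. -/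
def pairingHom : (g1 →ₗ[ℝ] g2) × g0 →ₗ[ℝ] (g0 →ₗ[ℝ] g2) × g1 →ₗ[ℝ] g2 :=
  LinearMap.mk₂ ℝ pairing
    (fun a a' b => by simp [pairing_apply]; abel) (fun r a b => by simp [pairing_apply])
    (fun a b b' => by simp [pairing_apply]; abel) (fun r a b => by simp [pairing_apply])

/-- The operation `⋄` on `ḡ₀ × ḡ₀` as a bilinear map. -/
def diamond00Hom : (g1 →ₗ[ℝ] g2) × g0 →ₗ[ℝ] (g1 →ₗ[ℝ] g2) × g0 →ₗ[ℝ] (g1 →ₗ[ℝ] g2) × g0 :=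
  LinearMap.mk₂ ℝ L.diamond00
    (fun a a' b => hom_prod_ext (fun w => by simp [diamond00_fst]; abel) (by simp [diamond00_snd]))
    (fun r a b => hom_prod_ext (fun w => by simp [diamond00_fst]; module)
      (by simp [diamond00_snd]))
    (fun a b b' => hom_prod_ext (fun w => by simp [diamond00_fst]; abel) (by simp [diamond00_snd]))
    (fun r a b => hom_prod_ext (fun w => by simp [diamond00_fst]; module)
      (by simp [diamond00_snd]))

/-- The operation `⋄` on `ḡ₀ × ḡ₋₁` as a bilinear map. -/
def diamond01Hom : (g1 →ₗ[ℝ] g2) × g0 →ₗ[ℝ] (g0 →ₗ[ℝ] g2) × g1 →ₗ[ℝ] (g0 →ₗ[ℝ] g2) × g1 :=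
  LinearMap.mk₂ ℝ L.diamond01
    (fun a a' b => hom_prod_ext (fun w => by simp [diamond01_fst]; abel)
      (by simp [diamond01_snd]; abel))
    (fun r a b => hom_prod_ext (fun w => by simp [diamond01_fst]; module)
      (by simp [diamond01_snd]))
    (fun a b b' => hom_prod_ext (fun w => by simp [diamond01_fst]; abel)
      (by simp [diamond01_snd]; abel))
    (fun r a b => hom_prod_ext (fun w => by simp [diamond01_fst]; module)
      (by simp [diamond01_snd]))

/-- `Ω` as a trilinear map. -/
def omegaHom : (g1 →ₗ[ℝ] g2) × g0 →ₗ[ℝ] (g1 →ₗ[ℝ] g2) × g0 →ₗ[ℝ] (g1 →ₗ[ℝ] g2) × g0 →ₗ[ℝ]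
    (g0 →ₗ[ℝ] g2) × g1 :=
  LinearMap.mk₂ ℝ
    (fun a b =>
      { toFun := L.omega a b
        map_add' := fun c c' => hom_prod_ext (fun w => by simp [omega_fst]; abel)
          (by simp [omega_snd])
        map_smul' := fun r c => hom_prod_ext (fun w => by simp [omega_fst]; module)
          (by simp [omega_snd]) })
    (fun a a' b => LinearMap.ext fun c => hom_prod_ext (fun w => by simp [omega_fst]; abel)
      (by simp [omega_snd]))
    (fun r a b => LinearMap.ext fun c => hom_prod_ext (fun w => by simp [omega_fst]; module)
      (by simp [omega_snd]))
    (fun a b b' => LinearMap.ext fun c => hom_prod_ext (fun w => by simp [omega_fst]; abel)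
      (by simp [omega_snd]))
    (fun r a b => LinearMap.ext fun c => hom_prod_ext (fun w => by simp [omega_fst]; module)
      (by simp [omega_snd]))

/-! ### The CLWX axioms for the doubled complex. -/

theorem diamond00_self (a : (g1 →ₗ[ℝ] g2) × g0) : L.diamond00 a a = 0 :=
  hom_prod_ext (fun w => by simp [diamond00_fst, L.l3_001_alt])
    (by simp [diamond00_snd, L.l2_00_alt])

theorem omega_self_left (a b : (g1 →ₗ[ℝ] g2) × g0) : L.omega a a b = 0 :=
  hom_prod_ext
    (fun w => by
      simp [omega_fst, L.l4_0000_alt_left, L.l3_000_alt_left, L.l3_000_swap_left a.2 b.2])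
    (by simp [omega_snd, L.l3_000_alt_left])

theorem omega_self_right (a b : (g1 →ₗ[ℝ] g2) × g0) : L.omega a b b = 0 :=
  hom_prod_ext
    (fun w => by
      simp [omega_fst, L.l4_0000_alt_mid, L.l3_000_alt_left, L.l3_000_swap_left a.2 b.2])
    (by simp [omega_snd, L.l3_000_alt_right])

/-- The term of Ω that composes the Hom part of c with `l₃` cancels against the other half of the
pairing; the rest vanishes by skew-symmetry. -/
theorem pairing_omega_self (a b c : (g1 →ₗ[ℝ] g2) × g0) : pairing c (L.omega a b c) = 0 := by
  have h : L.l3_000 c.2 a.2 c.2 = 0 := by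
    rw [L.l3_000_swap_right c.2 c.2 a.2, L.l3_000_alt_left, neg_zero]
  simp [pairing_apply, omega_fst, omega_snd, L.l4_0000_alt_right, L.l3_000_alt_right, h]

theorem del_dee (u : g2) : L.del (L.dee u) = 0 :=
  hom_prod_ext
    (fun w => by
      simp only [del_fst, dee_fst, dee_snd]
      linear_combination (norm := simp) -L.jacobiIdentities.jac12 w u)
    (L.jacobiIdentities.jac2 u)

theorem pairing_del (f g : (g0 →ₗ[ℝ] g2) × g1) : pairing (L.del f) g = pairing (L.del g) f := by
  simp only [pairing_apply, del_fst, del_snd, L.l2_11_symm g.2 f.2]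
  abel

/-- No Jacobi identity enters: up to the 𝒟-term, the action on ḡ₋₁ is by construction dual to the
bracket on ḡ₀. -/
theorem pairing_diamond01 (a b : (g1 →ₗ[ℝ] g2) × g0) (f : (g0 →ₗ[ℝ] g2) × g1) :
    pairing b (L.diamond01 a f)
      = pairing a (L.dee (pairing b f)) - pairing (L.diamond00 a b) f := by
  simp only [pairing_apply, diamond01_fst, diamond01_snd, diamond00_fst, diamond00_snd, dee_fst,
    dee_snd, map_add]
  abel

theorem del_diamond01 (e : (g1 →ₗ[ℝ] g2) × g0) (f : (g0 →ₗ[ℝ] g2) × g1) :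
    L.del (L.diamond01 e f) = L.diamond00 e (L.del f) := by
  have J := L.jacobiIdentities
  obtain ⟨α, x⟩ := e
  obtain ⟨φ, y⟩ := f
  refine hom_prod_ext (fun w => ?_) ?_
  · have h1 := J.jac011 x w y
    have h2 := congrArg φ (J.jac01 x w)
    have h3 := J.jac12 y (α w)
    have h4 := J.jac12 w (α y)
    have h5 := congrArg α (J.jac11 w y)
    have h6 := congrArg φ (J.jac2 (α w))
    simp only [map_add, map_sub, map_zero] at h2 h5 h6
    simp only [del_fst, del_snd, diamond00_fst, diamond01_fst, diamond01_snd, map_add, map_sub,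
      map_neg, LinearMap.add_apply, L.l2_00_swap (L.l1_1 _), L.l3_001_swap (L.l1_1 _),
      L.l2_11_symm y w, L.l2_11_symm _ (L.l1_2 _), L.l2_11_symm _ (L.l2_01 _ _)]
    linear_combination (norm := abel) -h1 + h2 - h3 - h4 + h5 + h6
  · have h1 := J.jac01 x y
    have h2 := J.jac2 (α y)
    simp only [del_snd, diamond00_snd, diamond01_snd, map_add, L.l2_00_swap (L.l1_1 _)]
    linear_combination (norm := abel) h1 + h2

theorem diamond01_del (f g : (g0 →ₗ[ℝ] g2) × g1) :
    L.diamond01 (L.del f) g + L.diamond01 (L.del g) f = L.dee (pairing (L.del f) g) := by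
  have J := L.jacobiIdentities
  obtain ⟨φ, y⟩ := f
  obtain ⟨ψ, z⟩ := g
  refine hom_prod_ext (fun w => ?_) ?_
  · have h1 := J.jac011 w y z
    have h2 := congrArg ψ (J.jac01 w y)
    have h3 := congrArg φ (J.jac01 w z)
    have h4 := J.jac12 y (ψ w)
    have h5 := J.jac12 z (φ w)
    have h6 := congrArg ψ (J.jac2 (φ w))
    have h7 := congrArg φ (J.jac2 (ψ w))
    simp only [map_add, map_zero] at h2 h3 h6 h7
    simp only [del_fst, del_snd, dee_fst, diamond01_fst, pairing_apply, Prod.fst_add, map_add,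
      map_sub, LinearMap.add_apply, L.l2_11_symm z y, L.l2_11_symm _ (L.l1_2 _),
      L.l2_11_symm _ (L.l2_01 _ _)]
    linear_combination (norm := abel) h1 - h2 - h3 - h4 - h5 + h6 + h7
  · have h1 := J.jac11 y z
    simp only [del_fst, del_snd, dee_snd, diamond01_snd, pairing_apply, Prod.snd_add, map_add,
      map_sub, L.l2_11_symm z y]
    linear_combination (norm := abel) -h1

theorem diamond01_dee (e : (g1 →ₗ[ℝ] g2) × g0) (u : g2) :
    L.diamond01 e (L.dee u) = L.dee (pairing e (L.dee u)) := by
  have J := L.jacobiIdentities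
  obtain ⟨α, x⟩ := e
  refine hom_prod_ext (fun w => ?_) ?_
  · have h1 := J.jac002 x w u
    have h2 := congrArg α (J.jac02 w u)
    simp only [map_sub, map_zero] at h2
    simp only [dee_fst, dee_snd, diamond01_fst, pairing_apply, map_add]
    linear_combination (norm := abel) -h1 + h2
  · have h1 := J.jac02 x u
    simp only [dee_fst, dee_snd, diamond01_snd, pairing_apply, map_add]
    linear_combination (norm := abel) -h1

theorem diamond00_diamond00 (a b c : (g1 →ₗ[ℝ] g2) × g0) :
    L.diamond00 (L.diamond00 a b) c - L.diamond00 (L.diamond00 a c) b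
      + L.diamond00 (L.diamond00 b c) a + L.del (L.omega a b c) = 0 := by
  have J := L.jacobiIdentities
  obtain ⟨α, x⟩ := a
  obtain ⟨β, y⟩ := b
  obtain ⟨γ, z⟩ := c
  refine hom_prod_ext (fun w => ?_) ?_
  -- Sorted by Hom arguments: none gives `jac0001`, one gives `jac002` and `jac001`, two give
  -- `jac02`. Terms with all three cancel, as in the Jacobi identity for commutators.
  · have h1 := J.jac0001 x y z w
    have h2 := J.jac002 x y (γ w)
    have h3 := J.jac002 x z (β w)
    have h4 := J.jac002 y z (α w)
    have h5 := congrArg γ (J.jac001 x y w)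
    have h6 := congrArg β (J.jac001 x z w)
    have h7 := congrArg α (J.jac001 y z w)
    have h8 := congrArg γ (J.jac02 x (β w))
    have h9 := congrArg β (J.jac02 x (γ w))
    have h10 := congrArg γ (J.jac02 y (α w))
    have h11 := congrArg α (J.jac02 y (γ w))
    have h12 := congrArg α (J.jac02 z (β w))
    have h13 := congrArg β (J.jac02 z (α w))
    simp only [map_add, map_sub, map_zero] at h5 h6 h7 h8 h9 h10 h11 h12 h13
    simp only [del_fst, diamond00_fst, diamond00_snd, omega_fst, omega_snd, Prod.fst_add,
      Prod.fst_sub, Prod.fst_zero, map_add, map_sub, map_neg, LinearMap.add_apply,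
      LinearMap.sub_apply, LinearMap.zero_apply, L.l4_0000_rotate _ _ _ (L.l1_1 _),
      ← L.l3_000_rotate _ _ (L.l1_1 _), L.l3_000_swap_right _ x z]
    linear_combination (norm := abel) h1 + h2 - h3 + h4 - h5 + h6 - h7
      - h8 + h9 + h10 - h11 + h12 - h13
  · have h1 := J.jac000 x y z
    simp only [del_snd, diamond00_snd, omega_snd, Prod.snd_add, Prod.snd_sub, Prod.snd_zero]
    linear_combination (norm := abel) h1

theorem diamond01_diamond01 (a b : (g1 →ₗ[ℝ] g2) × g0) (f : (g0 →ₗ[ℝ] g2) × g1) :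
    L.diamond01 a (L.diamond01 b f) - L.diamond01 b (L.diamond01 a f)
      - L.diamond01 (L.diamond00 a b) f = L.omega a b (L.del f) := by
  have J := L.jacobiIdentities
  obtain ⟨α, x⟩ := a
  obtain ⟨β, y⟩ := b
  obtain ⟨φ, c⟩ := f
  refine hom_prod_ext (fun w => ?_) ?_
  · have h1 := J.jac0001 x y w c
    have h2 := congrArg φ (J.jac000 x y w)
    have h3 := J.jac002 x y (φ w)
    have h4 := J.jac002 x w (β c)
    have h5 := J.jac002 y w (α c)
    have h6 := congrArg β (J.jac001 x w c)
    have h7 := congrArg α (J.jac001 y w c)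
    have h8 := congrArg β (J.jac02 x (φ w))
    have h9 := congrArg α (J.jac02 y (φ w))
    have h10 := congrArg β (J.jac02 w (α c))
    have h11 := congrArg α (J.jac02 w (β c))
    simp only [map_add, map_sub, map_zero] at h2 h6 h7 h8 h9 h10 h11
    simp only [del_fst, del_snd, diamond00_fst, diamond00_snd, diamond01_fst, diamond01_snd,
      omega_fst, Prod.fst_sub, map_add, map_sub, map_neg, LinearMap.sub_apply,
      L.l4_0000_rotate_left _ _ (L.l1_1 _), L.l3_000_swap_left (L.l1_1 _),
      L.l3_001_swap (L.l2_00 _ _), L.l2_00_swap (L.l2_00 _ _), L.l2_11_symm c]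
    linear_combination (norm := abel) h1 + h2 - h3 - h4 + h5 + h6 - h7
      - h8 + h9 - h10 + h11
  · have h1 := J.jac001 x y c
    have h2 := J.jac02 x (β c)
    have h3 := J.jac02 y (α c)
    simp only [del_snd, diamond00_fst, diamond00_snd, diamond01_snd, omega_snd, Prod.snd_sub,
      map_add, map_sub, ← L.l3_000_rotate _ _ (L.l1_1 _)]
    linear_combination (norm := abel) -h1 - h2 + h3

/-- In the Hom component, terms free of α, β, γ, δ form `jac00000`, those linear in one of them form
`jac0000` with it applied, and the quadratic ones cancel. -/
theorem diamond01_omega (a b c d : (g1 →ₗ[ℝ] g2) × g0) :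
    L.omega (L.diamond00 a b) c d - L.omega (L.diamond00 a c) b d
      + L.omega (L.diamond00 a d) b c + L.omega (L.diamond00 b c) a d
      - L.omega (L.diamond00 b d) a c + L.omega (L.diamond00 c d) a b
      + L.diamond01 d (L.omega a b c) - L.diamond01 c (L.omega a b d)
      + L.diamond01 b (L.omega a c d) - L.diamond01 a (L.omega b c d)
      = L.dee (pairing d (L.omega a b c)) := by
  have J := L.jacobiIdentities
  obtain ⟨α, x⟩ := a
  obtain ⟨β, y⟩ := b
  obtain ⟨γ, z⟩ := c
  obtain ⟨δ, t⟩ := d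
  refine hom_prod_ext (fun w => ?_) ?_
  · have h1 := J.jac00000 x y z t w
    have h2 := congrArg δ (J.jac0000 x y z w)
    have h3 := congrArg γ (J.jac0000 x y t w)
    have h4 := congrArg β (J.jac0000 x z t w)
    have h5 := congrArg α (J.jac0000 y z t w)
    simp only [map_add, map_sub, map_zero] at h2 h3 h4 h5
    simp only [dee_fst, diamond00_fst, diamond00_snd, diamond01_fst, omega_fst, omega_snd,
      pairing_apply, Prod.fst_add, Prod.fst_sub, map_add, map_sub, map_neg, LinearMap.add_apply,
      LinearMap.sub_apply, L.l4_0000_rotate _ _ _ (L.l2_00 _ _), L.l3_000_swap_left (L.l2_00 _ _),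
      ← L.l3_000_rotate _ _ (L.l2_00 _ _), L.l3_000_swap_left x z, L.l3_000_swap_left x t,
      L.l3_000_swap_left y t, L.l3_000_swap_right _ x z, L.l3_000_swap_right _ x t,
      L.l3_000_swap_right _ y t]
    linear_combination (norm := abel) -h1 - h2 + h3 - h4 + h5
  · have h1 := J.jac0000 x y z t
    simp only [dee_snd, diamond00_snd, diamond01_snd, omega_fst, omega_snd, pairing_apply,
      Prod.snd_add, Prod.snd_sub, map_add, map_sub, map_neg, L.l3_000_swap_left x z]
    linear_combination (norm := abel) h1

/-- The CLWX 2-algebra of a Lie 3-algebra. -/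
def clwx : CLWX2Algebra ((g1 →ₗ[ℝ] g2) × g0) ((g0 →ₗ[ℝ] g2) × g1) g2 where
  del := L.delHom
  dee := L.deeHom
  S := pairingHom
  br := L.diamond00Hom
  act := L.diamond01Hom
  Om := L.omegaHom
  br_self := L.diamond00_self
  Om_self_left := L.omega_self_left
  Om_self_right := L.omega_self_right
  S_Om_self := L.pairing_omega_self
  del_dee := L.del_dee
  S_del := L.pairing_del
  del_act := L.del_diamond01
  act_del := L.diamond01_del
  act_dee := L.diamond01_dee
  S_act := L.pairing_diamond01
  br_br := L.diamond00_diamond00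
  act_act := L.diamond01_diamond01
  act_Om := L.diamond01_omega

/-! ### Comparison with the prescribed brackets. -/

/-- The symmetric part of ⋄ is 𝒟-exact, which is why skew-symmetrizing amounts to subtracting ½ 𝒟S.
-/
theorem diamond10_eq (f : (g0 →ₗ[ℝ] g2) × g1) (e : (g1 →ₗ[ℝ] g2) × g0) :
    L.diamond10 f e = L.dee (pairing e f) - L.diamond01 e f := by
  refine hom_prod_ext (fun w => ?_) ?_ <;>
  simp [diamond10, diamond01, dee, pairing] <;> abel

theorem clwx_skewAct (e : (g1 →ₗ[ℝ] g2) × g0) (f : (g0 →ₗ[ℝ] g2) × g1) :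
    L.clwx.skewAct e f = L.courant01 e f := by
  rw [courant01, diamond10_eq, CLWX2Algebra.skewAct_apply]
  change L.diamond01 e f - (1 / 2 : ℝ) • L.dee (pairing e f) = _
  module

theorem courant10_eq (f : (g0 →ₗ[ℝ] g2) × g1) (e : (g1 →ₗ[ℝ] g2) × g0) :
    L.courant10 f e = -L.courant01 e f := by
  rw [courant01, courant10]
  module

theorem clwx_negT (a b : (g1 →ₗ[ℝ] g2) × g0) (f : (g0 →ₗ[ℝ] g2) × g1) :
    L.clwx.negT a b f = -L.tee a b f := by
  rw [CLWX2Algebra.negT_apply, clwx_skewAct, clwx_skewAct, tee, courant10_eq, sub_eq_add_neg,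
    ← map_neg]
  rfl

end Lie3Algebra

theorem mainTheorem6 {g0 g1 g2 : Type*} [AddCommGroup g0] [Module ℝ g0]
    [AddCommGroup g1] [Module ℝ g1] [AddCommGroup g2] [Module ℝ g2]
    (L : Lie3Algebra g0 g1 g2) :
    ∃ M : Lie3Algebra ((g1 →ₗ[ℝ] g2) × g0) ((g0 →ₗ[ℝ] g2) × g1) g2,
      (∀ u, M.l1_2 u = L.dee u) ∧
      (∀ f, M.l1_1 f = L.del f) ∧
      (∀ e₁ e₂, M.l2_00 e₁ e₂ = L.diamond00 e₁ e₂) ∧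
      (∀ e f, M.l2_01 e f = (1 / 2 : ℝ) • (L.diamond01 e f - L.diamond10 f e)) ∧
      (∀ e u, M.l2_02 e u = (1 / 2 : ℝ) • Lie3Algebra.pairing e (L.dee u)) ∧
      (∀ f₁ f₂, M.l2_11 f₁ f₂ = 0) ∧
      (∀ e₁ e₂ e₃, M.l3_000 e₁ e₂ e₃ = L.omega e₁ e₂ e₃) ∧
      (∀ e₁ e₂ f, M.l3_001 e₁ e₂ f = -L.tee e₁ e₂ f) ∧
      (∀ e₁ e₂ e₃ e₄, M.l4_0000 e₁ e₂ e₃ e₄ = L.omegaBar e₁ e₂ e₃ e₄) :=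
  -- Only the two brackets involving the skew-symmetrized action need comparison; the others agree
  -- definitionally.
  ⟨L.clwx.toLie3Algebra, fun _ => rfl, fun _ => rfl, fun _ _ => rfl, L.clwx_skewAct,
    fun _ _ => rfl, fun _ _ => rfl, fun _ _ _ => rfl, L.clwx_negT, fun _ _ _ _ => rfl⟩
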